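/- **Setting.** A *matrix ordered operator space* is a (not necessarily complete) operator space $V$ (matrix norms $\|\cdot\|_n$ on $M_n(V)$ satisfying Ruan's axioms) which is also a complex $*$-vector space with closed convex cones $M_n(V)^+\subset M_n(V)_{sa}$ such that $\alpha^*M_m(V)^+\alpha\subset M_n(V)^+$ for all $\alpha\in M_{m,n}(\mathbb C)$, and such that the involution is isometric on every $M_n(V)$. It is *matrix regular* if for all $n$ and all $v\in M_n(V)_{sa}$: (1) $u\in M_n(V)^+$ and $-u\le v\le u$ imply $\|v\|_n\le\|u\|_n$; (2) if $\|v\|_n<1$, there is $u\in M_n(V)^+$ with $\|u\|_n<1$ and $-u\le v\le u$. "c.p." means completely positive, "c.c.p." means completely positive and completely contractive; $M_k=M_k(\mathbb C)$ has its usual norm and order. The dual $V^*$ (all bounded linear functionals, with $f^*(v)=\overline{f(v^*)}$) carries the structure given by $M_n(V^*)=CB(V,M_n)$ with the completely bounded norm, and $M_n(V^*)^+=CB(V,M_n)\cap CP(V,M_n)$. The space $V\otimes_\delta W$ is the algebraic tensor product $V\otimes W$ (with $(v\otimes w)^*=v^*\otimes w^*$) with the following structure. Let $M_n(V\otimes_\delta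 W)_+$ be the set of all $z\in M_n(V\otimes W)$ such that $(\varphi\otimes\psi)_n(z)\in M_{nkl}^+$ for all $k,l$ and all continuous c.p. maps $\varphi:V\to M_k$, $\psi:W\to M_l$. Put $$|z|_\delta=\sup\{\|(\varphi\otimes\psi)_n(z)\| : \varphi:V\to M_k,\ \psi:W\to M_l \text{ c.c.p.},\ k,l\in\mathbb N\},$$ $$\|z\|_\delta=\inf\Big\{\max\{|u|_\delta,|u'|_\delta\} : \begin{pmatrix}u&z\\z^*&u'\end{pmatrix}\in M_{2n}(V\otimes_\delta W)_+\Big\}\qquad(z\in M_n(V\otimes W)).$$ The norm on $M_n(V\otimes_\delta W)$ is $\|\cdot\|_\delta$, and the positive cone $M_n(V\otimes_\delta W)^+$ is the $\|\cdot\|_\delta$-closure of $M_n(V\otimes_\delta W)_+$. The same formulas, with $V^*$ in place of $V$, define $V^*\otimes_\delta W$. The space $D(V,W)$ of decomposable maps is the linear span of the completely bounded c.p. maps $V\to W$. For $T:V\to W$ put $T^*(v)=T(v^*)^*$ and $$\|T\|_{dec}=\inf\Big\{\max\{\|S_1\|_{cb},\|S_2\|_{cb}\} : v\mapsto\begin{pmatrix}S_1(v)&T(v)\\T^*(v)&S_2(v)\end{pmatrix}\in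 M_2(W)\text{ is c.p.}\Big\}.$$ The matrix levels of $D(V,W)$ are $M_n(D(V,W))=D(V,M_n(W))$, with the norm $\|\cdot\|_{dec}$ of $D(V,M_n(W))$, and $M_n(D(V,W))^+$ consists of the c.p. maps $V\to M_n(W)$ in $M_n(D(V,W))$. **Theorem.** Let $V$ and $W$ be matrix regular operator spaces. There is a linear map $\Psi:V^*\otimes_\delta W\to D(V,W)$ given by $\Psi(f\otimes w)(v)=f(v)\,w$. It is injective and completely contractive, and it is a complete order isomorphism onto its image: for all $n$ and $z\in M_n(V^*\otimes W)$, $z\in M_n(V^*\otimes_\delta W)^+$ if and only if $\Psi_n(z)\in M_n(D(V,W))^+$. If $V$ or $W$ is finite dimensional, then $\Psi$ is bijective and completely isometric. -/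

import Mathlib

open scoped ENNReal NNReal Matrix Kronecker TensorProduct ComplexOrder

universe u v

noncomputable section

/-! ## Matrix norms and matrix cones

The matrix level `M_n(V)` is represented by `Matrix ι ι V` for an arbitrary finite index type `ι`
(`n = |ι|`), so that `M_k(M_n(V)) = M_{kn}(V)` and `2 × 2` block matrices need no renumbering.
By the compatibility with rectangular scalar matrices required below, norms and cones do not depend
on the enumeration of `ι`, so this is the same as a structure on `M_n(V)` for all `n`. -/

/-- The data of a matrix norm and of matrix cones on a complex vector space (no laws). -/
class MatrixNormCone (V : Type u) [AddCommGroup V] [Module ℂ V] where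
  /-- the norm on `M_ι(V)`, with values in `[0, ∞]` -/
  mnorm : ∀ {ι : Type} [Fintype ι], Matrix ι ι V → ℝ≥0∞
  /-- the cone `M_ι(V)^+` -/
  cone : ∀ (ι : Type) [Fintype ι], Set (Matrix ι ι V)

open MatrixNormCone

open scoped Matrix.Norms.L2Operator in
open scoped Classical in
/-- The operator norm of a rectangular scalar matrix between Euclidean spaces. -/
def opNorm {ι κ : Type} [Fintype ι] [Fintype κ] (α : Matrix ι κ ℂ) : ℝ := ‖α‖

/-- The product `α A β` with scalar matrices `α, β` and a matrix `A` over `V`. -/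
def scalarMul {V : Type u} [AddCommGroup V] [Module ℂ V] {ι κ : Type} [Fintype ι]
    (α : Matrix κ ι ℂ) (A : Matrix ι ι V) (β : Matrix ι κ ℂ) : Matrix κ κ V :=
  Matrix.of fun i j => ∑ k, ∑ l, (α i k * β l j) • A k l

/-- (Not necessarily complete) abstract operator spaces, by Ruan's axioms. -/
class OperatorSpace (V : Type u) [AddCommGroup V] [Module ℂ V] [MatrixNormCone V] : Prop where
  mnorm_ne_top : ∀ {ι : Type} [Fintype ι] (A : Matrix ι ι V), mnorm A ≠ ∞
  mnorm_add_le : ∀ {ι : Type} [Fintype ι] (A B : Matrix ι ι V),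
    mnorm (A + B) ≤ mnorm A + mnorm B
  mnorm_smul : ∀ {ι : Type} [Fintype ι] (c : ℂ) (A : Matrix ι ι V),
    mnorm (c • A) = ‖c‖ₑ * mnorm A
  eq_zero_of_mnorm : ∀ {ι : Type} [Fintype ι] (A : Matrix ι ι V), mnorm A = 0 → A = 0
  mnorm_diag : ∀ {ι κ : Type} [Fintype ι] [Fintype κ] (A : Matrix ι ι V) (B : Matrix κ κ V),
    mnorm (Matrix.fromBlocks A 0 0 B) = max (mnorm A) (mnorm B)
  mnorm_scalarMul_le : ∀ {ι κ : Type} [Fintype ι] [Fintype κ]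
    (α : Matrix κ ι ℂ) (A : Matrix ι ι V) (β : Matrix ι κ ℂ),
    mnorm (scalarMul α A β) ≤ ENNReal.ofReal (opNorm α) * mnorm A * ENNReal.ofReal (opNorm β)

/-- Matrix ordered operator spaces: an operator space and a `*`-vector space with cones
`M_n(V)^+ ⊆ M_n(V)_sa` compatible with scalar matrices, such that the involution is isometric and
the cones are closed. -/
class MatrixOrderedOperatorSpace (V : Type u) [AddCommGroup V] [Module ℂ V] [StarAddMonoid V]
    [StarModule ℂ V] [MatrixNormCone V] : Prop extends OperatorSpace V where
  isSelfAdjoint_of_mem : ∀ {ι : Type} [Fintype ι] {A : Matrix ι ι V}, A ∈ cone ι → Aᴴ = A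
  zero_mem_cone : ∀ (ι : Type) [Fintype ι], (0 : Matrix ι ι V) ∈ cone ι
  add_mem_cone : ∀ {ι : Type} [Fintype ι] {A B : Matrix ι ι V},
    A ∈ cone ι → B ∈ cone ι → A + B ∈ cone ι
  smul_mem_cone : ∀ {ι : Type} [Fintype ι] {A : Matrix ι ι V} (r : ℝ), 0 ≤ r →
    A ∈ cone ι → (r : ℂ) • A ∈ cone ι
  conj_mem_cone : ∀ {ι κ : Type} [Fintype ι] [Fintype κ] {A : Matrix ι ι V} (α : Matrix ι κ ℂ),
    A ∈ cone ι → scalarMul αᴴ A α ∈ cone κ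
  mnorm_conjTranspose : ∀ {ι : Type} [Fintype ι] (A : Matrix ι ι V), mnorm Aᴴ = mnorm A
  cone_closed : ∀ {ι : Type} [Fintype ι] (A : Matrix ι ι V),
    (∀ ε : ℝ≥0∞, 0 < ε → ∃ B ∈ cone (V := V) ι, mnorm (A - B) < ε) → A ∈ cone ι

/-- Matrix regular operator spaces. -/
class MatrixRegularOperatorSpace (V : Type u) [AddCommGroup V] [Module ℂ V] [StarAddMonoid V]
    [StarModule ℂ V] [MatrixNormCone V] : Prop extends MatrixOrderedOperatorSpace V where
  /-- `-u ≤ v ≤ u` implies `‖v‖ ≤ ‖u‖` -/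
  mnorm_le_of_le : ∀ {ι : Type} [Fintype ι] (v u : Matrix ι ι V), vᴴ = v → u ∈ cone ι →
    v + u ∈ cone ι → u - v ∈ cone ι → mnorm v ≤ mnorm u
  /-- if `‖v‖ < 1` then `-u ≤ v ≤ u` for some `u ≥ 0` with `‖u‖ < 1` -/
  exists_dominating : ∀ {ι : Type} [Fintype ι] (v : Matrix ι ι V), vᴴ = v → mnorm v < 1 →
    ∃ u ∈ cone (V := V) ι, mnorm u < 1 ∧ v + u ∈ cone ι ∧ u - v ∈ cone ι

/-! ## Scalars and matrices -/

/-- `M_n(ℂ)` with the operator norm and the cone of positive semidefinite matrices. -/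
instance instMatrixNormConeComplex : MatrixNormCone ℂ where
  mnorm A := ENNReal.ofReal (opNorm A)
  cone _ _ := {A | A.PosSemidef}

/-- The structure on `M_κ(Y)` given by `M_ι(M_κ(Y)) = M_{ι × κ}(Y)`. With `Y = ℂ` this is the
usual structure on the matrix algebra `M_κ`. -/
instance instMatrixNormConeMatrix {Y : Type u} [AddCommGroup Y] [Module ℂ Y] [MatrixNormCone Y]
    {κ : Type} [Fintype κ] : MatrixNormCone (Matrix κ κ Y) where
  mnorm {ι} _ A := mnorm (Matrix.comp ι ι κ κ Y A)
  cone ι _ := {A | Matrix.comp ι ι κ κ Y A ∈ cone (ι × κ)}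

/-! ## Classes of linear maps -/

section Maps

variable {X : Type u} [AddCommGroup X] [Module ℂ X] [MatrixNormCone X]
variable {Y : Type v} [AddCommGroup Y] [Module ℂ Y] [MatrixNormCone Y]

/-- The norm of an element, i.e. the norm on `M_1(X) = X`. -/
def elemNorm (x : X) : ℝ≥0∞ := mnorm (Matrix.of fun _ _ : Unit => x)

/-- Continuous (bounded) linear maps. -/
def IsBoundedMap (T : X →ₗ[ℂ] Y) : Prop :=
  ∃ C : ℝ≥0, ∀ x, elemNorm (T x) ≤ C * elemNorm x

/-- Completely positive maps. -/
def IsCP (T : X →ₗ[ℂ] Y) : Prop :=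
  ∀ (ι : Type) [Fintype ι] (A : Matrix ι ι X), A ∈ cone ι → A.map T ∈ cone ι

/-- Complete contractions. -/
def IsCompleteContraction (T : X →ₗ[ℂ] Y) : Prop :=
  ∀ (ι : Type) [Fintype ι] (A : Matrix ι ι X), mnorm (A.map T) ≤ mnorm A

/-- Complete isometries. -/
def IsCompleteIsometry (T : X →ₗ[ℂ] Y) : Prop :=
  ∀ (ι : Type) [Fintype ι] (A : Matrix ι ι X), mnorm (A.map T) = mnorm A

/-- Complete order isomorphisms onto the image (the image carrying the cones induced by `Y`):
injective maps such that `A ≥ 0` if and only if `T_n(A) ≥ 0`, for all `A ∈ M_n(X)`. -/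
def IsCompleteOrderEmbedding (T : X →ₗ[ℂ] Y) : Prop :=
  Function.Injective T ∧
    ∀ (ι : Type) [Fintype ι] (A : Matrix ι ι X), A.map T ∈ cone ι ↔ A ∈ cone ι

/-- The completely bounded norm (`∞` if the map is not completely bounded). -/
def cbNorm (T : X →ₗ[ℂ] Y) : ℝ≥0∞ :=
  ⨆ (ι : Type) (_ : Fintype ι) (A : Matrix ι ι X) (_ : mnorm A ≤ 1), mnorm (A.map T)

end Maps

/-- A matrix of linear maps `X → Y`, regarded as the linear map `X → M_ι(Y)`,
`x ↦ [F i j x]`. -/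
def matrixMap {X : Type u} {Y : Type v} [AddCommGroup X] [Module ℂ X] [AddCommGroup Y]
    [Module ℂ Y] {ι : Type} (F : Matrix ι ι (X →ₗ[ℂ] Y)) : X →ₗ[ℂ] Matrix ι ι Y where
  toFun x := Matrix.of fun i j => F i j x
  map_add' x y := by ext i j; simp
  map_smul' c x := by ext i j; simp

/-- The adjoint `T^*(x) = T(x^*)^*` of a linear map between `*`-vector spaces. -/
def adjointMap {X : Type u} {Y : Type v} [AddCommGroup X] [Module ℂ X] [StarAddMonoid X]
    [StarModule ℂ X] [AddCommGroup Y] [Module ℂ Y] [StarAddMonoid Y] [StarModule ℂ Y]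
    (T : X →ₗ[ℂ] Y) : X →ₗ[ℂ] Y where
  toFun x := star (T (star x))
  map_add' x y := by simp
  map_smul' c x := by simp [star_smul]

/-! ## The dual -/

section Dual

variable (V : Type u) [AddCommGroup V] [Module ℂ V] [MatrixNormCone V]

theorem elemNorm_complex (c : ℂ) : elemNorm c = ‖c‖ₑ := by
  classical
  have h : opNorm (Matrix.of fun _ _ : Unit => c) = ‖c‖ := by
    have e : (Matrix.of fun _ _ : Unit => c) = Matrix.diagonal (fun _ : Unit => c) := by
      ext i j; simp
    rw [e, opNorm]
    have := Matrix.l2_opNorm_diagonal (𝕜 := ℂ) (fun _ : Unit => c)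
    rw [← pi_norm_const (ι := Unit) c, ← this]
    congr!
  change ENNReal.ofReal (opNorm (Matrix.of fun _ _ : Unit => c)) = _
  rw [h, ofReal_norm]

/-- The dual `V^*`: the space of bounded linear functionals on `V`. -/
def boundedDual : Submodule ℂ (V →ₗ[ℂ] ℂ) where
  carrier := {f | IsBoundedMap f}
  zero_mem' := ⟨0, fun x => by simp [elemNorm_complex]⟩
  add_mem' := by
    rintro f g ⟨C, hC⟩ ⟨D, hD⟩
    refine ⟨C + D, fun x => ?_⟩
    simp only [elemNorm_complex] at hC hD ⊢
    rw [LinearMap.add_apply, ENNReal.coe_add, add_mul]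
    exact (enorm_add_le _ _).trans (add_le_add (hC x) (hD x))
  smul_mem' := by
    rintro c f ⟨C, hC⟩
    refine ⟨‖c‖₊ * C, fun x => ?_⟩
    simp only [elemNorm_complex] at hC ⊢
    rw [LinearMap.smul_apply, smul_eq_mul, enorm_mul, ENNReal.coe_mul, mul_assoc]
    exact mul_le_mul_right (hC x) _

/-- The structure of `V^*`: `M_n(V^*)` is identified with the maps `V → M_n`, normed by the
completely bounded norm and ordered by complete positivity. -/
instance instMatrixNormConeDual : MatrixNormCone (boundedDual V) where
  mnorm F := cbNorm (matrixMap (F.map fun f => (f : V →ₗ[ℂ] ℂ)))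
  cone _ _ := {F | IsCP (matrixMap (F.map fun f => (f : V →ₗ[ℂ] ℂ)))}

variable {V} [StarAddMonoid V] [StarModule ℂ V] [MatrixOrderedOperatorSpace V]

theorem elemNorm_star (x : V) : elemNorm (star x) = elemNorm x := by
  rw [elemNorm, elemNorm, ← MatrixOrderedOperatorSpace.mnorm_conjTranspose]
  congr 1
  ext i j
  simp

/-- The involution `f^*(v) = conj (f (v^*))` on `V^*`. -/
instance instStarAddMonoidDual : StarAddMonoid (boundedDual V) where
  star f := ⟨adjointMap f.1, by
    obtain ⟨C, hC⟩ := f.2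
    refine ⟨C, fun x => ?_⟩
    have h := hC (star x)
    rw [elemNorm_star] at h
    simp only [elemNorm_complex] at h ⊢
    simpa [adjointMap] using h⟩
  star_involutive f := by
    ext x; simp [adjointMap]
  star_add f g := by
    ext x; simp [adjointMap]

instance instStarModuleDual : StarModule ℂ (boundedDual V) where
  star_smul c f := by
    ext x
    change star ((c • (f : V →ₗ[ℂ] ℂ)) (star x)) = star c • star (f.1 (star x))
    simp

end Dual

/-! ## The tensor product `V ⊗_δ W` -/

section Delta

variable {V : Type u} [AddCommGroup V] [Module ℂ V] [StarAddMonoid V] [StarModule ℂ V]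
  [MatrixNormCone V]
variable {W : Type v} [AddCommGroup W] [Module ℂ W] [StarAddMonoid W] [StarModule ℂ W]
  [MatrixNormCone W]

/-- The map `φ ⊗ ψ : V ⊗ W → M_k ⊗ M_l = M_{kl}`, `v ⊗ w ↦ φ(v) ⊗ ψ(w)` (Kronecker product). -/
def tensorMap {κ μ : Type} (φ : V →ₗ[ℂ] Matrix κ κ ℂ) (ψ : W →ₗ[ℂ] Matrix μ μ ℂ) :
    V ⊗[ℂ] W →ₗ[ℂ] Matrix (κ × μ) (κ × μ) ℂ :=
  TensorProduct.lift (LinearMap.mk₂ ℂ (fun v w => φ v ⊗ₖ ψ w)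
    (fun v v' w => by rw [map_add, Matrix.add_kronecker])
    (fun c v w => by rw [map_smul, Matrix.smul_kronecker])
    (fun v w w' => by rw [map_add, Matrix.kronecker_add])
    (fun c v w => by rw [map_smul, Matrix.kronecker_smul]))

/-- The cone `M_n(V ⊗_δ W)_+` (before closure). -/
def deltaCone (ι : Type) [Fintype ι] : Set (Matrix ι ι (V ⊗[ℂ] W)) :=
  {z | ∀ (κ μ : Type) [Fintype κ] [Fintype μ]
    (φ : V →ₗ[ℂ] Matrix κ κ ℂ) (ψ : W →ₗ[ℂ] Matrix μ μ ℂ),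
    IsCP φ → IsBoundedMap φ → IsCP ψ → IsBoundedMap ψ → z.map (tensorMap φ ψ) ∈ cone ι}

/-- The quantity `|z|_δ`: the supremum of `‖(φ ⊗ ψ)_n(z)‖` over completely positive complete
contractions `φ : V → M_k` and `ψ : W → M_l`. -/
def deltaAbs {ι : Type} [Fintype ι] (z : Matrix ι ι (V ⊗[ℂ] W)) : ℝ≥0∞ :=
  ⨆ (κ : Type) (μ : Type) (_ : Fintype κ) (_ : Fintype μ)
    (φ : V →ₗ[ℂ] Matrix κ κ ℂ) (ψ : W →ₗ[ℂ] Matrix μ μ ℂ)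
    (_ : IsCP φ ∧ IsCompleteContraction φ) (_ : IsCP ψ ∧ IsCompleteContraction ψ),
    mnorm (z.map (tensorMap φ ψ))

/-- The norm `‖z‖_δ` on `M_n(V ⊗ W)`: the infimum of `max {|u|_δ, |u'|_δ}` over all `u, u'` such
that the block matrix with rows `(u, z)` and `(z^*, u')` lies in `M_{2n}(V ⊗_δ W)_+`. -/
def deltaNorm {ι : Type} [Fintype ι] (z : Matrix ι ι (V ⊗[ℂ] W)) : ℝ≥0∞ :=
  ⨅ (a : Matrix ι ι (V ⊗[ℂ] W)) (b : Matrix ι ι (V ⊗[ℂ] W))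
    (_ : Matrix.fromBlocks a z zᴴ b ∈ deltaCone (V := V) (W := W) (ι ⊕ ι)),
    max (deltaAbs a) (deltaAbs b)

/-- The matrix ordered operator space structure of `V ⊗_δ W`; the cone `M_n(V ⊗_δ W)^+` is the
closure of `M_n(V ⊗_δ W)_+` in the norm `‖·‖_δ`. -/
instance instMatrixNormConeDelta : MatrixNormCone (V ⊗[ℂ] W) where
  mnorm z := deltaNorm z
  cone ι _ := {z | ∀ ε : ℝ≥0∞, 0 < ε →
    ∃ y ∈ deltaCone (V := V) (W := W) ι, deltaNorm (z - y) < ε}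

end Delta

/-! ## Decomposable maps -/

section Dec

/-- The decomposable norm: the infimum of `max {‖S₁‖_cb, ‖S₂‖_cb}` over all `S₁, S₂` such that
`v ↦ [[S₁ v, T v], [T^* v, S₂ v]]` is completely positive into `M_2(Y)`. -/
def decNorm {V : Type u} [AddCommGroup V] [Module ℂ V] [StarAddMonoid V] [StarModule ℂ V]
    [MatrixNormCone V] {Y : Type v} [AddCommGroup Y] [Module ℂ Y] [StarAddMonoid Y]
    [StarModule ℂ Y] [MatrixNormCone Y] (T : V →ₗ[ℂ] Y) : ℝ≥0∞ :=
  ⨅ (S₁ : V →ₗ[ℂ] Y) (S₂ : V →ₗ[ℂ] Y)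
    (_ : IsCP (matrixMap !![S₁, T; adjointMap T, S₂])), max (cbNorm S₁) (cbNorm S₂)

variable (V : Type u) [AddCommGroup V] [Module ℂ V] [MatrixNormCone V]
variable (W : Type v) [AddCommGroup W] [Module ℂ W] [MatrixNormCone W]

/-- The space `D(V, W)` of decomposable maps: linear combinations of completely bounded completely
positive maps. -/
def decMaps : Submodule ℂ (V →ₗ[ℂ] W) :=
  Submodule.span ℂ {S | IsCP S ∧ cbNorm S < ∞}

/-- The structure of `D(V, W)`: `M_n(D(V, W)) = D(V, M_n(W))` with the decomposable norm, and
`M_n(D(V, W))^+` consists of the completely positive maps `V → M_n(W)`. -/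
instance instMatrixNormConeDec [StarAddMonoid V] [StarModule ℂ V] [StarAddMonoid W]
    [StarModule ℂ W] : MatrixNormCone (decMaps V W) where
  mnorm F := decNorm (matrixMap (F.map fun T => (T : V →ₗ[ℂ] W)))
  cone _ _ := {F | IsCP (matrixMap (F.map fun T => (T : V →ₗ[ℂ] W)))}

end Dec

end

set_option linter.unusedSectionVars false

noncomputable section

open MatrixNormCone

/-! ## The operator norm of scalar matrices -/

/-! A matrix `z` over `V^* ⊗ W` is the same thing as a map `T_z : V → M_n(W)` with entries of finite
rank, and both parts of the δ-structure can be read off `T_z`.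

Order: `z` lies in the unclosed cone exactly when `T_z` is completely positive
(`mem_deltaCone_iff`). If `z` is in the cone, test it with evaluation at a positive matrix over `V`,
which is a c.p. map on `V^*`. This makes every `ψ` of `T_z(a)` positive, and the cones of `W` are
detected by c.p. maps into matrix algebras (`mem_cone_of_forall_isCP`, by Hahn-Banach). Conversely,
if `T_z` is c.p., then `ψ ∘ T_z` is c.p., so `(id ⊗ ψ)(z)` is positive over `V^*` by definition, and
`φ` preserves this.

Size: when `T_u` is c.p., `|u|_δ` equals its cb norm (`cbNorm_matrixToMap_le_deltaAbs`,
`deltaAbs_le_cbNorm_matrixToMap`). This needs the norm of a positive matrix over `W` to be attained,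
up to ε, on c.c.p. maps into matrix algebras (`mnorm_le_of_forall_isCP`). That is the hardest step.

Hence `‖z‖_δ` and `‖T_z‖_dec` are infima of the same quantity over the same positive `2 × 2` blocks,
except that δ only admits diagonal entries of finite rank. So `Ψ` is completely contractive. If `V`
or `W` is finite dimensional, every completely bounded diagonal entry has finite rank and the infima
agree. Closing the cone adds nothing, because `cb ≤ dec ≤ δ` and the cones of `W` are closed. Rank
one maps are decomposable because bounded functionals and elements of `W` are combinations of
positive ones. -/

/-- The Euclidean norm of a vector of complex numbers. -/
def l2Norm {ι : Type} [Fintype ι] (ξ : ι → ℂ) : ℝ :=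
  ‖(WithLp.toLp 2 ξ : EuclideanSpace ℂ ι)‖

section OpNorm

variable {ι κ μ : Type} [Fintype ι] [Fintype κ] [Fintype μ]

theorem l2Norm_nonneg (ξ : ι → ℂ) : 0 ≤ l2Norm ξ := norm_nonneg _

theorem l2Norm_sq (ξ : ι → ℂ) : l2Norm ξ ^ 2 = ∑ i, ‖ξ i‖ ^ 2 := by
  rw [l2Norm, EuclideanSpace.norm_sq_eq]

theorem star_dotProduct_self (ξ : ι → ℂ) : star ξ ⬝ᵥ ξ = ((l2Norm ξ ^ 2 : ℝ) : ℂ) := by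
  rw [l2Norm_sq, dotProduct]
  push_cast
  refine Finset.sum_congr rfl fun i _ => ?_
  simpa using Complex.conj_mul' (ξ i)

theorem norm_star_dotProduct_le (η ξ : ι → ℂ) : ‖star η ⬝ᵥ ξ‖ ≤ l2Norm η * l2Norm ξ := by
  have h := norm_inner_le_norm (𝕜 := ℂ) (WithLp.toLp 2 η : EuclideanSpace ℂ ι) (WithLp.toLp 2 ξ)
  rw [EuclideanSpace.inner_toLp_toLp] at h
  rwa [dotProduct_comm]

open scoped Matrix.Norms.L2Operator in
theorem opNorm_eq [DecidableEq κ] (α : Matrix ι κ ℂ) : opNorm α = ‖α‖ := by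
  unfold opNorm
  congr!

theorem opNorm_nonneg (α : Matrix ι κ ℂ) : 0 ≤ opNorm α := by
  classical
  rw [opNorm_eq]
  let _ := Matrix.instL2OpNormedAddCommGroup (m := ι) (n := κ) (𝕜 := ℂ)
  exact norm_nonneg α

theorem opNorm_conjTranspose (α : Matrix ι κ ℂ) : opNorm αᴴ = opNorm α := by
  classical
  rw [opNorm_eq, opNorm_eq, Matrix.l2_opNorm_conjTranspose]

theorem opNorm_mul_le (α : Matrix ι κ ℂ) (β : Matrix κ μ ℂ) :
    opNorm (α * β) ≤ opNorm α * opNorm β := by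
  classical
  rw [opNorm_eq, opNorm_eq, opNorm_eq]
  exact Matrix.l2_opNorm_mul α β

theorem opNorm_conjTranspose_mul_self (α : Matrix ι κ ℂ) :
    opNorm (αᴴ * α) = opNorm α ^ 2 := by
  classical
  rw [opNorm_eq, opNorm_eq, Matrix.l2_opNorm_conjTranspose_mul_self, sq]

theorem opNorm_one_le [DecidableEq ι] : opNorm (1 : Matrix ι ι ℂ) ≤ 1 := by
  rw [opNorm_eq, ← Matrix.diagonal_one, Matrix.l2_opNorm_diagonal]
  exact (pi_norm_le_iff_of_nonneg zero_le_one).2 fun i => by simp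

theorem l2Norm_mulVec_le (α : Matrix ι κ ℂ) (ξ : κ → ℂ) :
    l2Norm (α *ᵥ ξ) ≤ opNorm α * l2Norm ξ := by
  classical
  rw [opNorm_eq]
  exact Matrix.l2_opNorm_mulVec α (WithLp.toLp 2 ξ)

theorem star_star_dotProduct_mulVec (α : Matrix ι κ ℂ) (η : ι → ℂ) (ξ : κ → ℂ) :
    star (star η ⬝ᵥ (α *ᵥ ξ)) = star ξ ⬝ᵥ (αᴴ *ᵥ η) := by
  rw [← Matrix.star_dotProduct_star, Matrix.star_mulVec, star_star, Matrix.dotProduct_mulVec]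

theorem norm_dotProduct_mulVec_le (α : Matrix ι κ ℂ) (η : ι → ℂ) (ξ : κ → ℂ) :
    ‖star η ⬝ᵥ (α *ᵥ ξ)‖ ≤ opNorm α * (l2Norm η * l2Norm ξ) := by
  refine (norm_star_dotProduct_le _ _).trans ?_
  have := mul_le_mul_of_nonneg_left (l2Norm_mulVec_le α ξ) (l2Norm_nonneg η)
  linarith

theorem opNorm_le_of_forall {α : Matrix ι κ ℂ} {C : ℝ} (hC : 0 ≤ C)
    (h : ∀ η ξ, ‖star η ⬝ᵥ (α *ᵥ ξ)‖ ≤ C * (l2Norm η * l2Norm ξ)) : opNorm α ≤ C := by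
  classical
  rw [opNorm_eq, Matrix.l2_opNorm_def]
  refine ContinuousLinearMap.opNorm_le_bound _ hC fun x => ?_
  change l2Norm (α *ᵥ x.ofLp) ≤ C * l2Norm x.ofLp
  have := h (α *ᵥ x.ofLp) x.ofLp
  rw [star_dotProduct_self, Complex.norm_real, Real.norm_of_nonneg (sq_nonneg _)] at this
  rcases (l2Norm_nonneg (α *ᵥ x.ofLp)).eq_or_lt with h0 | h0
  · rw [← h0]
    exact mul_nonneg hC (l2Norm_nonneg _)
  · refine le_of_mul_le_mul_left ?_ h0
    linarith

/-- The form `⟨η, αξ⟩` is the inner product of `α`, read as a vector, with `η ⊗ ξ̄`, so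
Cauchy-Schwarz bounds the operator norm by the Hilbert-Schmidt norm. -/
theorem opNorm_le_l2Norm (α : Matrix ι κ ℂ) :
    opNorm α ≤ l2Norm (fun p : ι × κ => α p.1 p.2) := by
  refine opNorm_le_of_forall (l2Norm_nonneg _) fun η ξ => ?_
  have e : star η ⬝ᵥ (α *ᵥ ξ)
      = star (fun p : ι × κ => η p.1 * star (ξ p.2)) ⬝ᵥ (fun p : ι × κ => α p.1 p.2) := by
    simp only [dotProduct, Matrix.mulVec, Fintype.sum_prod_type, Finset.mul_sum, Pi.star_apply,
      star_mul', star_star]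
    exact Finset.sum_congr rfl fun i _ => Finset.sum_congr rfl fun j _ => by ring
  have e2 : l2Norm (fun p : ι × κ => η p.1 * star (ξ p.2)) = l2Norm η * l2Norm ξ := by
    refine (pow_left_inj₀ (l2Norm_nonneg _)
      (mul_nonneg (l2Norm_nonneg _) (l2Norm_nonneg _)) two_ne_zero).1 ?_
    rw [mul_pow, l2Norm_sq, l2Norm_sq, l2Norm_sq, Finset.sum_mul_sum, Fintype.sum_prod_type]
    simp [mul_pow]
  rw [e, ← e2, mul_comm]
  exact norm_star_dotProduct_le _ _

/-- Over the complex numbers, matrices with nonnegative quadratic form are hermitian. -/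
theorem posSemidef_of_forall {α : Matrix ι ι ℂ} (h : ∀ ξ, 0 ≤ star ξ ⬝ᵥ (α *ᵥ ξ)) :
    α.PosSemidef := by
  classical
  refine Matrix.PosSemidef.of_dotProduct_mulVec_nonneg ?_ h
  rw [← Matrix.isSymmetric_toEuclideanLin_iff, LinearMap.isSymmetric_iff_inner_map_self_real]
  intro x
  have hx := h x.ofLp
  have e : inner ℂ (Matrix.toEuclideanLin α x) x = star (star x.ofLp ⬝ᵥ (α *ᵥ x.ofLp)) := by
    rw [← WithLp.toLp_ofLp (p := 2) x, Matrix.toLpLin_toLp, EuclideanSpace.inner_toLp_toLp,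
      Matrix.star_dotProduct, star_star, dotProduct_comm]
    rfl
  rw [e, starRingEnd_apply, star_star]
  exact (Complex.conj_eq_iff_im.2 (Complex.nonneg_iff.1 hx).2.symm).symm

theorem posSemidef_smul_one_sub [DecidableEq ι] {α : Matrix ι ι ℂ} (h : αᴴ = α) {r : ℝ}
    (hr : opNorm α ≤ r) : ((r : ℂ) • (1 : Matrix ι ι ℂ) - α).PosSemidef := by
  refine Matrix.PosSemidef.of_dotProduct_mulVec_nonneg ?_ fun ξ => ?_
  · rw [Matrix.IsHermitian, Matrix.conjTranspose_sub, h]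
    simp
  · rw [Matrix.sub_mulVec, dotProduct_sub, Matrix.smul_mulVec, Matrix.one_mulVec,
      dotProduct_smul, star_dotProduct_self, sub_nonneg]
    have h1 := norm_dotProduct_mulVec_le α ξ ξ
    have h2 : (star ξ ⬝ᵥ (α *ᵥ ξ)).im = 0 := by
      rw [← Complex.conj_eq_iff_im, ← Complex.star_def, star_star_dotProduct_mulVec, h]
    rw [Complex.le_def]
    refine ⟨?_, by rw [h2, smul_eq_mul, ← Complex.ofReal_mul, Complex.ofReal_im]⟩
    refine (Complex.re_le_norm _).trans (h1.trans ?_)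
    rw [← sq, smul_eq_mul, ← Complex.ofReal_mul, Complex.ofReal_re]
    exact mul_le_mul_of_nonneg_right hr (sq_nonneg _)

/-- Positivity on `(η, ξ)` gives `-2 Re ⟨η, xξ⟩ ≤ ‖η‖² + ‖ξ‖²`. Rescaling the two vectors separately
turns the sum into a product, and a phase turns the real part into the modulus. -/
theorem opNorm_le_one_of_fromBlocks [DecidableEq ι] {a b x y : Matrix ι ι ℂ}
    (h : (Matrix.fromBlocks a x y b).PosSemidef) (ha : (1 - a).PosSemidef)
    (hb : (1 - b).PosSemidef) : opNorm x ≤ 1 := by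
  have hy : y = xᴴ := by
    have := h.1
    rw [Matrix.IsHermitian, Matrix.fromBlocks_conjTranspose, Matrix.fromBlocks_inj] at this
    exact this.2.2.1.symm
  subst hy
  have key : ∀ η ξ, -2 * (star η ⬝ᵥ (x *ᵥ ξ)).re ≤ l2Norm η ^ 2 + l2Norm ξ ^ 2 := by
    intro η ξ
    have h0 := (Complex.nonneg_iff.1 (h.dotProduct_mulVec_nonneg (Sum.elim η ξ))).1
    have h1 := (Complex.nonneg_iff.1 (ha.dotProduct_mulVec_nonneg η)).1
    have h2 := (Complex.nonneg_iff.1 (hb.dotProduct_mulVec_nonneg ξ)).1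
    rw [Matrix.sub_mulVec, dotProduct_sub, Matrix.one_mulVec, star_dotProduct_self,
      Complex.sub_re, Complex.ofReal_re] at h1 h2
    have e := (star_star_dotProduct_mulVec x η ξ).symm
    have e2 : star (Sum.elim η ξ) = Sum.elim (star η) (star ξ) := by
      ext i; cases i <;> rfl
    rw [Matrix.fromBlocks_mulVec, e2, sumElim_dotProduct_sumElim] at h0
    simp only [Function.comp_def, Sum.elim_inl, Sum.elim_inr, dotProduct_add] at h0
    rw [e] at h0
    simp only [Complex.add_re, Complex.star_def, Complex.conj_re] at h0
    linarith
  refine opNorm_le_of_forall zero_le_one fun η ξ => ?_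
  rw [one_mul]
  have key2 : ∀ η ξ, -(star η ⬝ᵥ (x *ᵥ ξ)).re ≤ l2Norm η * l2Norm ξ := by
    intro η ξ
    have hs : ∀ (c : ℝ) (ζ : ι → ℂ), l2Norm ((c : ℂ) • ζ) ^ 2 = c ^ 2 * l2Norm ζ ^ 2 := by
      intro c ζ
      simp only [l2Norm_sq, Finset.mul_sum, Pi.smul_apply, smul_eq_mul, norm_mul, mul_pow]
      simp
    have hst : ∀ s t : ℝ, -2 * (s * t * (star η ⬝ᵥ (x *ᵥ ξ)).re)
        ≤ s ^ 2 * l2Norm η ^ 2 + t ^ 2 * l2Norm ξ ^ 2 := by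
      intro s t
      have := key ((s : ℂ) • η) ((t : ℂ) • ξ)
      rw [hs, hs, Matrix.mulVec_smul, star_smul, smul_dotProduct, dotProduct_smul, smul_smul] at this
      convert this using 3
      simp [← Complex.ofReal_mul]
    set A := l2Norm η with hA
    set B := l2Norm ξ with hB
    have hA0 : 0 ≤ A := l2Norm_nonneg _
    have hB0 : 0 ≤ B := l2Norm_nonneg _
    set r := (star η ⬝ᵥ (x *ᵥ ξ)).re
    refine le_of_forall_pos_le_add fun ε hε => ?_
    by_contra hcon
    push Not at hcon
    rcases hA0.eq_or_lt with hA' | hA'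
    · rw [← hA'] at hst hcon
      -- When `η` has norm zero the right side does not depend on `s`, so a large `s` contradicts a
      -- nonzero real part. When both norms are positive the choice is `s = ‖ξ‖`, `t = ‖η‖`.
      have h1 := hst ((B ^ 2 + 1) / ε) 1
      have hr : ε < -r := by linarith
      have h2 : (B ^ 2 + 1) ≤ (B ^ 2 + 1) / ε * -r := by
        rw [div_mul_eq_mul_div, le_div_iff₀ hε]
        exact mul_le_mul_of_nonneg_left hr.le (by positivity)
      nlinarith
    · have h1 := hst B A
      rcases hB0.eq_or_lt with hB' | hB'
      · rw [← hB'] at hst hcon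
        have h1 := hst 1 ((A ^ 2 + 1) / ε)
        have hr : ε < -r := by linarith
        have h2 : (A ^ 2 + 1) ≤ (A ^ 2 + 1) / ε * -r := by
          rw [div_mul_eq_mul_div, le_div_iff₀ hε]
          exact mul_le_mul_of_nonneg_left hr.le (by positivity)
        nlinarith
      · have h3 : B * A * (-r) ≤ B * A * (A * B) := by nlinarith
        have := le_of_mul_le_mul_left h3 (mul_pos hB' hA')
        linarith
  by_cases hz : star η ⬝ᵥ (x *ᵥ ξ) = 0
  · rw [hz, norm_zero]
    exact mul_nonneg (l2Norm_nonneg _) (l2Norm_nonneg _)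
  · set z := star η ⬝ᵥ (x *ᵥ ξ) with hzdef
    have hn : (‖z‖ : ℂ) ≠ 0 := by simpa using hz
    -- This phase makes the form equal to `-‖z‖`.
    have h1 := key2 η ((-(star z) / ‖z‖ : ℂ) • ξ)
    have hc : l2Norm ((-(star z) / ‖z‖ : ℂ) • ξ) = l2Norm ξ := by
      rw [l2Norm, WithLp.toLp_smul, norm_smul, l2Norm, norm_div, norm_neg, norm_star,
        Complex.norm_real, norm_norm, div_self (by simpa using hz), one_mul]
    rw [hc, Matrix.mulVec_smul, dotProduct_smul, ← hzdef, smul_eq_mul, div_mul_eq_mul_div,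
      neg_mul, Complex.star_def, Complex.conj_mul'] at h1
    have e : (-(‖z‖ : ℂ) ^ 2 / ‖z‖) = ((-‖z‖ : ℝ) : ℂ) := by
      push_cast
      field_simp
    rw [e, Complex.ofReal_re, neg_neg] at h1
    exact h1

end OpNorm

/-! ## Scalar multiplication of matrices over a vector space -/

section ScalarMul

variable {X : Type u} [AddCommGroup X] [Module ℂ X] {Y : Type v} [AddCommGroup Y] [Module ℂ Y]
variable {ι κ μ : Type} [Fintype ι] [Fintype κ] [Fintype μ]

theorem scalarMul_add (α : Matrix κ ι ℂ) (A B : Matrix ι ι X) (β : Matrix ι κ ℂ) :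
    scalarMul α (A + B) β = scalarMul α A β + scalarMul α B β := by
  ext i j
  simp [scalarMul, Finset.sum_add_distrib]

theorem scalarMul_smul (c : ℂ) (α : Matrix κ ι ℂ) (A : Matrix ι ι X) (β : Matrix ι κ ℂ) :
    scalarMul α (c • A) β = c • scalarMul α A β := by
  ext i j
  simp only [scalarMul, Matrix.smul_apply, Matrix.of_apply, Finset.smul_sum]
  exact Finset.sum_congr rfl fun k _ => Finset.sum_congr rfl fun l _ => smul_comm _ _ _

theorem smul_scalarMul_smul (c d : ℂ) (α : Matrix κ ι ℂ) (A : Matrix ι ι X) (β : Matrix ι κ ℂ) :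
    scalarMul (c • α) A (d • β) = (c * d) • scalarMul α A β := by
  ext i j
  simp only [scalarMul, Matrix.smul_apply, Matrix.of_apply, Finset.smul_sum, smul_eq_mul, smul_smul]
  exact Finset.sum_congr rfl fun k _ => Finset.sum_congr rfl fun l _ => by ring_nf

theorem scalarMul_scalarMul (γ : Matrix μ κ ℂ) (α : Matrix κ ι ℂ) (A : Matrix ι ι X)
    (β : Matrix ι κ ℂ) (δ : Matrix κ μ ℂ) :
    scalarMul γ (scalarMul α A β) δ = scalarMul (γ * α) A (β * δ) := by
  ext i j
  simp only [scalarMul, Matrix.of_apply, Matrix.mul_apply, Finset.smul_sum, smul_smul,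
    Finset.sum_mul_sum, Finset.sum_smul]
  rw [Finset.sum_comm' (t' := Finset.univ) (s' := fun _ => Finset.univ) (by simp)]
  have : ∀ l : κ, ∑ k : κ, ∑ a : ι, ∑ b : ι, (γ i k * δ l j * (α k a * β b l)) • A a b
      = ∑ a : ι, ∑ b : ι, ∑ k : κ, (γ i k * δ l j * (α k a * β b l)) • A a b := by
    intro l
    rw [Finset.sum_comm]
    exact Finset.sum_congr rfl fun a _ => Finset.sum_comm
  simp only [this]
  rw [Finset.sum_comm]
  refine Finset.sum_congr rfl fun a _ => ?_
  rw [Finset.sum_comm]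
  refine Finset.sum_congr rfl fun b _ => ?_
  rw [Finset.sum_comm]
  exact Finset.sum_congr rfl fun k _ => Finset.sum_congr rfl fun l _ => by ring_nf

theorem scalarMul_one [DecidableEq ι] (A : Matrix ι ι X) :
    scalarMul (1 : Matrix ι ι ℂ) A 1 = A := by
  ext i j
  simp [scalarMul, Matrix.one_apply]

theorem scalarMul_complex (α : Matrix κ ι ℂ) (A : Matrix ι ι ℂ) (β : Matrix ι κ ℂ) :
    scalarMul α A β = α * A * β := by
  ext i j
  simp only [scalarMul, Matrix.of_apply, Matrix.mul_apply, Finset.sum_mul, smul_eq_mul]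
  rw [Finset.sum_comm]
  exact Finset.sum_congr rfl fun k _ => Finset.sum_congr rfl fun l _ => by ring

open scoped Classical in
/-- The scalar matrix which selects the rows and columns indexed by `f`. -/
def selection (f : κ → ι) : Matrix ι κ ℂ := (1 : Matrix ι ι ℂ).submatrix id f

/-- Blocks, permutations and repetitions of indices thereby fall under the axioms for scalar
matrices. -/
theorem submatrix_eq_scalarMul (A : Matrix ι ι X) (e f : κ → ι) :
    A.submatrix e f = scalarMul (selection e)ᴴ A (selection f) := by
  ext i j
  simp only [scalarMul, selection, Matrix.conjTranspose_submatrix, Matrix.conjTranspose_one,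
    Matrix.submatrix_apply, id, Matrix.of_apply, Matrix.one_apply]
  rw [Finset.sum_eq_single (e i) (fun b _ hb => by simp [hb.symm]) (by simp),
    Finset.sum_eq_single (f j) (fun b _ hb => by simp [hb]) (by simp)]
  simp

theorem opNorm_selection_le {f : κ → ι} (hf : Function.Injective f) :
    opNorm (selection f) ≤ 1 := by
  classical
  have h : (selection f)ᴴ * selection f = 1 := by
    ext i j
    simp [selection, Matrix.mul_apply, Matrix.one_apply, hf.eq_iff, apply_ite]
  have h1 := opNorm_conjTranspose_mul_self (selection f)
  rw [h] at h1
  have h2 : opNorm (selection f) ^ 2 ≤ 1 := h1 ▸ opNorm_one_le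
  exact (sq_le_one_iff₀ (opNorm_nonneg _)).1 h2

end ScalarMul

/-! ## Operator spaces -/

section Operator

variable {X : Type u} [AddCommGroup X] [Module ℂ X] [MatrixNormCone X] [OperatorSpace X]
variable {Y : Type v} [AddCommGroup Y] [Module ℂ Y] [MatrixNormCone Y] [OperatorSpace Y]
variable {ι κ : Type} [Fintype ι] [Fintype κ]

theorem mnorm_zero : mnorm (0 : Matrix ι ι X) = 0 := by
  have h := OperatorSpace.mnorm_smul (0 : ℂ) (0 : Matrix ι ι X)
  simpa using h

theorem mnorm_neg (A : Matrix ι ι X) : mnorm (-A) = mnorm A := by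
  have h := OperatorSpace.mnorm_smul (-1 : ℂ) A
  simpa using h

theorem mnorm_scalarMul_le_of_le (α : Matrix κ ι ℂ) (A : Matrix ι ι X) (β : Matrix ι κ ℂ)
    {a b : ℝ} (ha : opNorm α ≤ a) (hb : opNorm β ≤ b) :
    mnorm (scalarMul α A β) ≤ ENNReal.ofReal a * mnorm A * ENNReal.ofReal b :=
  (OperatorSpace.mnorm_scalarMul_le α A β).trans (by gcongr)

theorem mnorm_submatrix_le (A : Matrix ι ι X) {e f : κ → ι} (he : Function.Injective e)
    (hf : Function.Injective f) : mnorm (A.submatrix e f) ≤ mnorm A := by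
  rw [submatrix_eq_scalarMul]
  refine (mnorm_scalarMul_le_of_le _ _ _ (a := 1) (b := 1) ?_ (opNorm_selection_le hf)).trans
    (by simp)
  rw [opNorm_conjTranspose]
  exact opNorm_selection_le he

theorem mnorm_submatrix_equiv (A : Matrix ι ι X) (e f : κ ≃ ι) :
    mnorm (A.submatrix e f) = mnorm A := by
  refine le_antisymm (mnorm_submatrix_le A e.injective f.injective) ?_
  have h := mnorm_submatrix_le (A.submatrix e f) e.symm.injective f.symm.injective
  simpa using h

theorem mnorm_offDiag (A B : Matrix ι ι X) :
    mnorm (Matrix.fromBlocks 0 A B 0) = max (mnorm A) (mnorm B) := by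
  rw [← OperatorSpace.mnorm_diag,
    ← mnorm_submatrix_equiv (Matrix.fromBlocks A 0 0 B) (Equiv.refl _) (Equiv.sumComm ι ι)]
  congr 1
  ext i j
  cases i <;> cases j <;> rfl

/-- A homogeneous function bounded by `c` on the open unit ball is bounded by `c` times the
norm. -/
theorem le_mul_mnorm_of_forall_lt_one {F : Matrix ι ι X → ℝ≥0∞} {c : ℝ≥0∞}
    (hF : ∀ (r : ℝ) A, 0 < r → F ((r : ℂ) • A) = ENNReal.ofReal r * F A) (hc : c ≠ ∞)
    (h : ∀ A, mnorm A < 1 → F A ≤ c) (A : Matrix ι ι X) : F A ≤ c * mnorm A := by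
  have hA := OperatorSpace.mnorm_ne_top A
  have key : ∀ ε : ℝ≥0, 0 < ε → F A ≤ c * (mnorm A + ε) := by
    intro ε hε
    -- Dividing by slightly more than the norm puts `A` in the open unit ball, also when the norm is
    -- zero.
    set t : ℝ := (mnorm A).toReal + ε with ht
    have ht0 : 0 < t := add_pos_of_nonneg_of_pos ENNReal.toReal_nonneg hε
    have ht1 : ENNReal.ofReal t = mnorm A + ε := by
      rw [ht, ENNReal.ofReal_add ENNReal.toReal_nonneg ε.coe_nonneg, ENNReal.ofReal_toReal hA]
      simp
    have hne : ENNReal.ofReal t ≠ 0 := by simpa using ht0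
    have h1 : mnorm (((t⁻¹ : ℝ) : ℂ) • A) < 1 := by
      rw [OperatorSpace.mnorm_smul, ← ofReal_norm, Complex.norm_real,
        Real.norm_of_nonneg (inv_pos.2 ht0).le, ENNReal.ofReal_inv_of_pos ht0, mul_comm,
        ← div_eq_mul_inv]
      refine ENNReal.div_lt_of_lt_mul' ?_
      rw [mul_one, ht1]
      exact ENNReal.lt_add_right hA (by simpa using hε.ne')
    have h2 := h _ h1
    rw [hF _ _ (inv_pos.2 ht0), ENNReal.ofReal_inv_of_pos ht0, mul_comm, ← div_eq_mul_inv,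
      ENNReal.div_le_iff hne ENNReal.ofReal_ne_top, ht1] at h2
    exact h2
  refine ENNReal.le_of_forall_pos_le_add fun ε hε _ => ?_
  by_cases hc0 : c = 0
  · have := key 1 one_pos
    rw [hc0, zero_mul] at this
    exact this.trans (zero_le)
  · have hcn : 0 < c.toNNReal := ENNReal.toNNReal_pos hc0 hc
    refine (key (ε / c.toNNReal) (div_pos hε hcn)).trans ?_
    rw [mul_add]
    gcongr
    rw [ENNReal.coe_div hcn.ne', ENNReal.coe_toNNReal hc, ENNReal.mul_div_cancel hc0 hc]

theorem mnorm_map_smul (T : X →ₗ[ℂ] Y) (r : ℝ) (A : Matrix ι ι X) (hr : 0 < r) :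
    mnorm (((r : ℂ) • A).map T) = ENNReal.ofReal r * mnorm (A.map T) := by
  have : ((r : ℂ) • A).map T = (r : ℂ) • A.map T := by
    ext i j; simp
  rw [this, OperatorSpace.mnorm_smul, ← ofReal_norm, Complex.norm_real, Real.norm_of_nonneg hr.le]

theorem mnorm_map_le_cbNorm {T : X →ₗ[ℂ] Y} {A : Matrix ι ι X} (hA : mnorm A ≤ 1) :
    mnorm (A.map T) ≤ cbNorm T :=
  le_iSup₂_of_le ι ‹_› (le_iSup₂_of_le A hA le_rfl)

theorem mnorm_map_le (T : X →ₗ[ℂ] Y) (A : Matrix ι ι X) :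
    mnorm (A.map T) ≤ cbNorm T * mnorm A := by
  by_cases h : cbNorm T = ∞
  -- In `[0, ∞]` the product `∞ * 0` is `0`, so an infinite cb norm still requires an argument at `A
  -- = 0`.
  · by_cases hA : mnorm A = 0
    · rw [OperatorSpace.eq_zero_of_mnorm A hA]
      have : (0 : Matrix ι ι X).map T = 0 := by ext; simp
      rw [this, mnorm_zero]
      exact zero_le
    · rw [h, ENNReal.top_mul hA]
      exact le_top
  · exact le_mul_mnorm_of_forall_lt_one (F := fun A => mnorm (A.map T)) (mnorm_map_smul T) h
      (fun A hA => mnorm_map_le_cbNorm hA.le) A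

theorem cbNorm_le_of_forall {T : X →ₗ[ℂ] Y} {c : ℝ≥0∞}
    (h : ∀ (ι : Type) [Fintype ι] (A : Matrix ι ι X), mnorm (A.map T) ≤ c * mnorm A) :
    cbNorm T ≤ c :=
  iSup₂_le fun ι _ => iSup₂_le fun A hA => (h ι A).trans (mul_le_of_le_one_right' hA)

theorem cbNorm_le_of_forall_lt_one {T : X →ₗ[ℂ] Y} {c : ℝ≥0∞}
    (h : ∀ (ι : Type) [Fintype ι] (A : Matrix ι ι X), mnorm A < 1 → mnorm (A.map T) ≤ c) :
    cbNorm T ≤ c := by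
  by_cases hc : c = ∞
  · exact hc ▸ le_top
  · exact cbNorm_le_of_forall fun ι _ =>
      le_mul_mnorm_of_forall_lt_one (F := fun A => mnorm (A.map T)) (mnorm_map_smul T) hc (h ι)

theorem isCompleteContraction_iff {T : X →ₗ[ℂ] Y} :
    IsCompleteContraction T ↔ cbNorm T ≤ 1 := by
  refine ⟨fun h => cbNorm_le_of_forall fun ι _ A => by simpa using h ι A, fun h ι _ A => ?_⟩
  exact (mnorm_map_le T A).trans (mul_le_of_le_one_left' h)

theorem isBoundedMap_of_cbNorm {T : X →ₗ[ℂ] Y} (h : cbNorm T ≠ ∞) : IsBoundedMap T := by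
  refine ⟨(cbNorm T).toNNReal, fun x => ?_⟩
  rw [ENNReal.coe_toNNReal h]
  exact mnorm_map_le T (Matrix.of fun _ _ : Unit => x)

end Operator

/-! ## Matrix algebras as operator spaces -/

theorem opNorm_fromBlocks_diag {ι κ : Type} [Fintype ι] [Fintype κ] (A : Matrix ι ι ℂ)
    (B : Matrix κ κ ℂ) :
    opNorm (Matrix.fromBlocks A 0 0 B) = max (opNorm A) (opNorm B) := by
  have hsub : ∀ {μ : Type} [Fintype μ] (f : μ → ι ⊕ κ), Function.Injective f →
      opNorm ((Matrix.fromBlocks A 0 0 B).submatrix f f)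
        ≤ opNorm (Matrix.fromBlocks A 0 0 B) := by
    intro μ _ f hf
    rw [submatrix_eq_scalarMul, scalarMul_complex]
    refine (opNorm_mul_le _ _).trans ?_
    refine (mul_le_of_le_one_right (opNorm_nonneg _) (opNorm_selection_le hf)).trans ?_
    refine (opNorm_mul_le _ _).trans ?_
    refine mul_le_of_le_one_left (opNorm_nonneg _) ?_
    rw [opNorm_conjTranspose]
    exact opNorm_selection_le hf
  refine le_antisymm ?_ (max_le (hsub Sum.inl Sum.inl_injective) (hsub Sum.inr Sum.inr_injective))
  set m := max (opNorm A) (opNorm B)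
  have hm : 0 ≤ m := le_max_of_le_left (opNorm_nonneg _)
  refine opNorm_le_of_forall hm fun η ξ => ?_
  have hη : l2Norm η ^ 2 = l2Norm (η ∘ Sum.inl) ^ 2 + l2Norm (η ∘ Sum.inr) ^ 2 := by
    simp [l2Norm_sq]
  have hξ : l2Norm ξ ^ 2 = l2Norm (ξ ∘ Sum.inl) ^ 2 + l2Norm (ξ ∘ Sum.inr) ^ 2 := by
    simp [l2Norm_sq]
  have e : star η ⬝ᵥ (Matrix.fromBlocks A 0 0 B *ᵥ ξ)
      = star (η ∘ Sum.inl) ⬝ᵥ (A *ᵥ (ξ ∘ Sum.inl))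
        + star (η ∘ Sum.inr) ⬝ᵥ (B *ᵥ (ξ ∘ Sum.inr)) := by
    rw [Matrix.fromBlocks_mulVec]
    simp [dotProduct]
  have h1 := (norm_dotProduct_mulVec_le A (η ∘ Sum.inl) (ξ ∘ Sum.inl)).trans
    (mul_le_mul_of_nonneg_right (le_max_left (opNorm A) (opNorm B))
      (mul_nonneg (l2Norm_nonneg _) (l2Norm_nonneg _)))
  have h2 := (norm_dotProduct_mulVec_le B (η ∘ Sum.inr) (ξ ∘ Sum.inr)).trans
    (mul_le_mul_of_nonneg_right (le_max_right (opNorm A) (opNorm B))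
      (mul_nonneg (l2Norm_nonneg _) (l2Norm_nonneg _)))
  rw [e]
  refine (norm_add_le _ _).trans ((add_le_add h1 h2).trans ?_)
  rw [← mul_add]
  refine mul_le_mul_of_nonneg_left ?_ hm
  refine abs_le_of_sq_le_sq' ?_ (mul_nonneg (l2Norm_nonneg _) (l2Norm_nonneg _)) |>.2
  rw [mul_pow, hη, hξ]
  nlinarith [sq_nonneg (l2Norm (η ∘ Sum.inl) * l2Norm (ξ ∘ Sum.inr)
    - l2Norm (η ∘ Sum.inr) * l2Norm (ξ ∘ Sum.inl))]

instance instOperatorSpaceComplex : OperatorSpace ℂ where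
  mnorm_ne_top _ := ENNReal.ofReal_ne_top
  mnorm_add_le {ι} _ A B := by
    classical
    change ENNReal.ofReal (opNorm (A + B)) ≤ ENNReal.ofReal (opNorm A) + ENNReal.ofReal (opNorm B)
    rw [← ENNReal.ofReal_add (opNorm_nonneg _) (opNorm_nonneg _), opNorm_eq, opNorm_eq, opNorm_eq]
    refine ENNReal.ofReal_le_ofReal ?_
    let _ := Matrix.instL2OpNormedAddCommGroup (m := ι) (n := ι) (𝕜 := ℂ)
    exact norm_add_le A B
  mnorm_smul {ι} _ c A := by
    classical
    change ENNReal.ofReal (opNorm (c • A)) = ‖c‖ₑ * ENNReal.ofReal (opNorm A)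
    rw [← ofReal_norm, ← ENNReal.ofReal_mul (norm_nonneg _), opNorm_eq, opNorm_eq]
    congr 1
    let _ := Matrix.instL2OpNormedAddCommGroup (m := ι) (n := ι) (𝕜 := ℂ)
    let _ := Matrix.instL2OpNormedSpace (m := ι) (n := ι) (𝕜 := ℂ)
    exact norm_smul c A
  eq_zero_of_mnorm {ι} _ A h := by
    classical
    have h1 : opNorm A ≤ 0 := ENNReal.ofReal_eq_zero.1 h
    rw [opNorm_eq] at h1
    let _ := Matrix.instL2OpNormedAddCommGroup (m := ι) (n := ι) (𝕜 := ℂ)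
    exact norm_le_zero_iff.1 h1
  mnorm_diag A B := by
    change ENNReal.ofReal _ = max (ENNReal.ofReal _) (ENNReal.ofReal _)
    rw [opNorm_fromBlocks_diag, ENNReal.ofReal_max]
  mnorm_scalarMul_le α A β := by
    change ENNReal.ofReal (opNorm _) ≤ _ * ENNReal.ofReal (opNorm A) * _
    rw [scalarMul_complex, ← ENNReal.ofReal_mul (opNorm_nonneg _),
      ← ENNReal.ofReal_mul (mul_nonneg (opNorm_nonneg _) (opNorm_nonneg _))]
    exact ENNReal.ofReal_le_ofReal ((opNorm_mul_le _ _).trans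
      (mul_le_mul_of_nonneg_right (opNorm_mul_le _ _) (opNorm_nonneg _)))

/-- The matrix `α ⊗ 1` acts as `α` on each slice `ξ(·, m)`, and the squared norms of the slices add
up. -/
theorem opNorm_kronecker_one_le {ι κ μ : Type} [Fintype ι] [Fintype κ] [Fintype μ] [DecidableEq μ]
    (α : Matrix ι κ ℂ) : opNorm (α ⊗ₖ (1 : Matrix μ μ ℂ)) ≤ opNorm α := by
  refine opNorm_le_of_forall (opNorm_nonneg _) fun η ξ => ?_
  refine (norm_star_dotProduct_le _ _).trans ?_
  have h : l2Norm ((α ⊗ₖ (1 : Matrix μ μ ℂ)) *ᵥ ξ) ≤ opNorm α * l2Norm ξ := by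
    refine abs_le_of_sq_le_sq' ?_ (mul_nonneg (opNorm_nonneg _) (l2Norm_nonneg _)) |>.2
    have hrow : ∀ i m, ((α ⊗ₖ (1 : Matrix μ μ ℂ)) *ᵥ ξ) (i, m) = (α *ᵥ fun k => ξ (k, m)) i := by
      intro i m
      simp [Matrix.mulVec, dotProduct, Fintype.sum_prod_type, Matrix.one_apply]
    rw [mul_pow, l2Norm_sq, l2Norm_sq, Fintype.sum_prod_type_right, Fintype.sum_prod_type_right,
      Finset.mul_sum]
    refine Finset.sum_le_sum fun m _ => ?_
    simp only [hrow]
    rw [← l2Norm_sq, ← l2Norm_sq (fun k => ξ (k, m)), ← mul_pow]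
    exact pow_le_pow_left₀ (l2Norm_nonneg _) (l2Norm_mulVec_le _ _) 2
  have := mul_le_mul_of_nonneg_left h (l2Norm_nonneg η)
  linarith

theorem comp_scalarMul {Y : Type u} [AddCommGroup Y] [Module ℂ Y] {ι κ μ : Type} [Fintype ι]
    [Fintype κ] [Fintype μ] [DecidableEq μ] (α : Matrix κ ι ℂ) (A : Matrix ι ι (Matrix μ μ Y))
    (β : Matrix ι κ ℂ) :
    Matrix.comp κ κ μ μ Y (scalarMul α A β)
      = scalarMul (α ⊗ₖ (1 : Matrix μ μ ℂ)) (Matrix.comp ι ι μ μ Y A) (β ⊗ₖ 1) := by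
  ext ⟨i, m⟩ ⟨j, n⟩
  simp [scalarMul, Fintype.sum_prod_type, Matrix.one_apply, Matrix.sum_apply]

instance instOperatorSpaceMatrix {Y : Type u} [AddCommGroup Y] [Module ℂ Y] [MatrixNormCone Y]
    [OperatorSpace Y] {μ : Type} [Fintype μ] : OperatorSpace (Matrix μ μ Y) where
  mnorm_ne_top _ := OperatorSpace.mnorm_ne_top (V := Y) _
  mnorm_add_le A B := OperatorSpace.mnorm_add_le (Matrix.comp _ _ _ _ Y A) (Matrix.comp _ _ _ _ Y B)
  mnorm_smul c A := OperatorSpace.mnorm_smul c (Matrix.comp _ _ _ _ Y A)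
  eq_zero_of_mnorm A h :=
    (Matrix.comp _ _ _ _ Y).injective (OperatorSpace.eq_zero_of_mnorm (Matrix.comp _ _ _ _ Y A) h)
  mnorm_diag A B := by
    refine Eq.trans ?_ (OperatorSpace.mnorm_diag (Matrix.comp _ _ _ _ Y A)
      (Matrix.comp _ _ _ _ Y B))
    rw [← mnorm_submatrix_equiv _ (Equiv.sumProdDistrib _ _ μ) (Equiv.sumProdDistrib _ _ μ)]
    change mnorm (Matrix.comp _ _ _ _ Y _) = _
    congr 1
    ext ⟨i, m⟩ ⟨j, n⟩
    cases i <;> cases j <;> rfl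
  mnorm_scalarMul_le α A β := by
    classical
    change mnorm (Matrix.comp _ _ _ _ Y _) ≤ _ * mnorm (Matrix.comp _ _ _ _ Y A) * _
    rw [comp_scalarMul]
    exact mnorm_scalarMul_le_of_le _ _ _ (opNorm_kronecker_one_le α) (opNorm_kronecker_one_le β)

/-! ## Functionals on matrix spaces and maps into matrix algebras -/

section Functional

variable {X : Type u} [AddCommGroup X] [Module ℂ X] {ι κ : Type} [Fintype ι] [Fintype κ]

open scoped Classical in
/-- The map `X → M_κ` which corresponds to a linear functional on `M_κ(X)`. -/
def functionalMap (G : Matrix κ κ X →ₗ[ℂ] ℂ) : X →ₗ[ℂ] Matrix κ κ ℂ where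
  toFun x := Matrix.of fun i j => G (Matrix.single i j x)
  map_add' x y := by ext i j; simp [Matrix.single_add]
  map_smul' c x := by
    ext i j
    simp only [Matrix.of_apply, RingHom.id_apply, Matrix.smul_apply]
    rw [← Matrix.smul_single, map_smul]

/-- Vectors in `ℂ^ι ⊗ ℂ^κ` are reshaped into `ι × κ` matrices. Positivity and norm estimates for the
associated map become statements about `G` on two-sided scalar multiples of `A`. -/
theorem functionalMap_dotProduct (G : Matrix κ κ X →ₗ[ℂ] ℂ) (A : Matrix ι ι X) (η ξ : ι × κ → ℂ) :
    star η ⬝ᵥ (Matrix.comp ι ι κ κ ℂ (A.map (functionalMap G)) *ᵥ ξ)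
      = G (scalarMul (Matrix.of fun k i => η (k, i) : Matrix ι κ ℂ)ᴴ A
          (Matrix.of fun k i => ξ (k, i) : Matrix ι κ ℂ)) := by
  classical
  have e : scalarMul (Matrix.of fun k i => η (k, i) : Matrix ι κ ℂ)ᴴ A
      (Matrix.of fun k i => ξ (k, i) : Matrix ι κ ℂ)
      = ∑ i, ∑ j, ∑ k, ∑ l, (star (η (k, i)) * ξ (l, j)) •
          Matrix.singleLinearMap ℂ i j (A k l) := by
    rw [Matrix.matrix_eq_sum_single (scalarMul _ A _)]
    refine Finset.sum_congr rfl fun i _ => Finset.sum_congr rfl fun j _ => ?_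
    change Matrix.singleLinearMap ℂ i j (∑ k, ∑ l, (star (η (k, i)) * ξ (l, j)) • A k l) = _
    simp only [map_sum, map_smul]
  rw [e]
  simp only [map_sum, map_smul, smul_eq_mul]
  change _ = ∑ i, ∑ j, ∑ k, ∑ l, star (η (k, i)) * ξ (l, j) * functionalMap G (A k l) i j
  simp only [dotProduct, Matrix.mulVec, Fintype.sum_prod_type, Matrix.comp_apply, Matrix.map_apply,
    Finset.mul_sum, Pi.star_apply]
  rw [Finset.sum_comm]
  refine Finset.sum_congr rfl fun i _ => ?_
  rw [Finset.sum_comm (s := Finset.univ (α := κ))]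
  refine Finset.sum_congr rfl fun k _ => ?_
  rw [Finset.sum_comm (s := Finset.univ (α := κ))]
  exact Finset.sum_congr rfl fun l _ => Finset.sum_congr rfl fun j _ => by ring

variable [MatrixNormCone X]

theorem isCP_functionalMap {G : Matrix κ κ X →ₗ[ℂ] ℂ}
    (h : ∀ (ι : Type) [Fintype ι] (A : Matrix ι ι X), A ∈ cone ι → ∀ α : Matrix ι κ ℂ,
      0 ≤ G (scalarMul αᴴ A α)) : IsCP (functionalMap G) := by
  intro ι _ A hA
  refine posSemidef_of_forall fun ξ => ?_
  rw [functionalMap_dotProduct]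
  exact h ι A hA _

/-- No factor depending on `κ` appears: the operator norm of a reshaped vector is at most its
Hilbert-Schmidt norm, which is the norm of the vector. -/
theorem cbNorm_functionalMap_le [OperatorSpace X] {G : Matrix κ κ X →ₗ[ℂ] ℂ} {C : ℝ≥0}
    (h : ∀ x, ‖G x‖ₑ ≤ C * mnorm x) : cbNorm (functionalMap G) ≤ C := by
  refine cbNorm_le_of_forall fun ι _ A => ?_
  have hA := OperatorSpace.mnorm_ne_top A
  have h1 : opNorm (Matrix.comp ι ι κ κ ℂ (A.map (functionalMap G))) ≤ C * (mnorm A).toReal := by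
    refine opNorm_le_of_forall (by positivity) fun η ξ => ?_
    rw [functionalMap_dotProduct]
    set α : Matrix ι κ ℂ := Matrix.of fun k i => η (k, i)
    set β : Matrix ι κ ℂ := Matrix.of fun k i => ξ (k, i)
    have hα : opNorm αᴴ ≤ l2Norm η := (opNorm_conjTranspose α).le.trans (opNorm_le_l2Norm α)
    have hβ : opNorm β ≤ l2Norm ξ := opNorm_le_l2Norm β
    have h2 := (h (scalarMul αᴴ A β)).trans
      (mul_le_mul_right (mnorm_scalarMul_le_of_le _ A _ hα hβ) _)
    have h3 := ENNReal.toReal_mono (by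
      exact ENNReal.mul_ne_top ENNReal.coe_ne_top (ENNReal.mul_ne_top
        (ENNReal.mul_ne_top ENNReal.ofReal_ne_top hA) ENNReal.ofReal_ne_top)) h2
    simp only [ENNReal.toReal_mul, toReal_enorm, ENNReal.coe_toReal,
      ENNReal.toReal_ofReal (l2Norm_nonneg _)] at h3
    calc _ ≤ _ := h3
      _ = _ := by ring
  calc mnorm (A.map (functionalMap G))
      = ENNReal.ofReal (opNorm (Matrix.comp ι ι κ κ ℂ (A.map (functionalMap G)))) := rfl
    _ ≤ ENNReal.ofReal (C * (mnorm A).toReal) := ENNReal.ofReal_le_ofReal h1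
    _ = C * mnorm A := by
      rw [ENNReal.ofReal_mul C.coe_nonneg, ENNReal.ofReal_toReal hA, ENNReal.ofReal_coe_nnreal]

end Functional

/-! ## Construction of functionals -/

/-- A form of the Hahn-Banach theorem: if `R` is a convex cone in `E × ℝ`, there is a linear
functional `g` such that `g x ≤ t` for all `(x, t)` in the cone. -/
theorem exists_linearMap_le_of_cone {E : Type*} [AddCommGroup E] [Module ℝ E] (R : E → ℝ → Prop)
    (zero : R 0 0) (add : ∀ {x y s t}, R x s → R y t → R (x + y) (s + t))
    (smul : ∀ {x t} (c : ℝ), 0 < c → R x t → R (c • x) (c * t))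
    (total : ∀ x, ∃ t, R x t) (nonneg : ∀ t, R 0 t → 0 ≤ t) :
    ∃ g : E →ₗ[ℝ] ℝ, ∀ x t, R x t → g x ≤ t := by
  let s : PointedCone ℝ (E × ℝ) :=
    { carrier := {p | R p.1 p.2}
      zero_mem' := zero
      add_mem' := fun h h' => add h h'
      smul_mem' := fun c p hp => by
        rcases eq_or_ne c 0 with rfl | hc
        · simpa using zero
        · exact smul (c : ℝ) (NNReal.coe_pos.2 (pos_iff_ne_zero.2 hc)) hp }
  -- The functional `(0, t) ↦ t` on `0 × ℝ` is extended by M. Riesz's theorem. Positivity on the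
  -- cone then reads `g(x, 0) + t ≥ 0`, which explains the sign in the witness.
  let f : E × ℝ →ₗ.[ℝ] ℝ :=
    { domain := Submodule.prod ⊥ ⊤
      toFun := LinearMap.snd ℝ E ℝ ∘ₗ Submodule.subtype _ }
  obtain ⟨g, hg, hgs⟩ := riesz_extension s f
    (by
      rintro ⟨⟨x, t⟩, hx, ht⟩ hxs
      obtain rfl : x = 0 := hx
      exact nonneg t hxs)
    (by
      rintro ⟨x, t⟩
      obtain ⟨t', ht'⟩ := total x
      refine ⟨⟨(0, t' - t), Submodule.zero_mem _, trivial⟩, ?_⟩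
      change R (0 + x) (t' - t + t)
      simpa using ht')
  refine ⟨-(g ∘ₗ LinearMap.inl ℝ E ℝ), fun x t h => ?_⟩
  have h1 := hgs (x, t) h
  have h2 : g (0, t) = t := hg ⟨(0, t), Submodule.zero_mem _, trivial⟩
  have h3 : g (x, t) = g (x, 0) + g (0, t) := by rw [← map_add]; simp
  simp only [LinearMap.neg_apply, LinearMap.comp_apply, LinearMap.inl_apply]
  linarith

/-! ### Self-adjoint parts and complexification -/

section SymPart

variable {X : Type u} [AddCommGroup X] [Module ℂ X] [StarAddMonoid X] [StarModule ℂ X] {ι : Type}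

/-- The self-adjoint part `(x + x^*) / 2` of a matrix. -/
def symPart : Matrix ι ι X →ₗ[ℝ] Matrix ι ι X where
  toFun x := (2⁻¹ : ℂ) • (x + xᴴ)
  map_add' x y := by
    rw [Matrix.conjTranspose_add, ← smul_add]
    congr 1
    abel
  map_smul' r x := by
    rw [← Complex.coe_smul r x, Matrix.conjTranspose_smul, RingHom.id_apply, ← Complex.coe_smul,
      smul_comm (r : ℂ), Complex.star_def, Complex.conj_ofReal, smul_add (r : ℂ)]

theorem symPart_apply (x : Matrix ι ι X) : symPart x = (2⁻¹ : ℂ) • (x + xᴴ) := rfl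

theorem symPart_of_isSelfAdjoint {x : Matrix ι ι X} (h : xᴴ = x) : symPart x = x := by
  rw [symPart_apply, h, ← two_smul ℂ x, smul_smul]
  norm_num

theorem symPart_of_skew {x : Matrix ι ι X} (h : xᴴ = -x) : symPart x = 0 := by
  rw [symPart_apply, h, add_neg_cancel, smul_zero]

theorem conjTranspose_symPart (x : Matrix ι ι X) : (symPart x)ᴴ = symPart x := by
  rw [symPart_apply, Matrix.conjTranspose_smul, Matrix.conjTranspose_add,
    Matrix.conjTranspose_conjTranspose, add_comm]
  simp

/-- Complexification of a real-linear functional which vanishes on skew-adjoint matrices. -/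
theorem exists_complex_of_real (g : Matrix ι ι X →ₗ[ℝ] ℝ)
    (hg : ∀ x, xᴴ = -x → g x = 0) :
    ∃ G : Matrix ι ι X →ₗ[ℂ] ℂ, (∀ x, (G x).re = g x) ∧ ∀ x, xᴴ = x → G x = g x := by
  refine ⟨Module.Dual.extendRCLike (𝕜 := ℂ) g, fun x => ?_, fun x hx => ?_⟩
  · rw [← RCLike.re_eq_complex_re]
    exact Module.Dual.re_extendRCLike_apply g x
  rw [Module.Dual.extendRCLike_apply, hg (RCLike.I • x)]
  · simp
  · rw [Matrix.conjTranspose_smul, hx]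
    simp

end SymPart

/-! ## Matrix ordered and matrix regular operator spaces -/

section Ordered

variable {X : Type u} [AddCommGroup X] [Module ℂ X] [StarAddMonoid X] [StarModule ℂ X]
  [MatrixNormCone X] [MatrixOrderedOperatorSpace X]
variable {ι κ : Type} [Fintype ι] [Fintype κ]

open MatrixOrderedOperatorSpace

theorem submatrix_mem_cone {A : Matrix ι ι X} (hA : A ∈ cone ι) (f : κ → ι) :
    A.submatrix f f ∈ cone κ := by
  rw [submatrix_eq_scalarMul]
  exact conj_mem_cone _ hA

theorem real_smul_mem_cone {A : Matrix ι ι X} {r : ℝ} (hr : 0 ≤ r) (hA : A ∈ cone ι) :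
    r • A ∈ cone ι := by
  rw [← Complex.coe_smul]
  exact smul_mem_cone r hr hA

theorem scalarMul_fromRows (A : Matrix ι ι X) (B : Matrix κ κ X) {μ : Type} [Fintype μ]
    (α : Matrix ι μ ℂ) (β : Matrix κ μ ℂ) :
    scalarMul (Matrix.fromRows α β)ᴴ (Matrix.fromBlocks A 0 0 B) (Matrix.fromRows α β)
      = scalarMul αᴴ A α + scalarMul βᴴ B β := by
  ext i j
  simp [scalarMul]

/-- Direct sums are not among the cone axioms. Conjugation by `[1 0]` and `[0 1]` moves the summands
into their corners. -/
theorem fromBlocks_diag_mem_cone {A : Matrix ι ι X} {B : Matrix κ κ X} (hA : A ∈ cone ι)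
    (hB : B ∈ cone κ) : Matrix.fromBlocks A 0 0 B ∈ cone (ι ⊕ κ) := by
  classical
  have e : Matrix.fromBlocks A 0 0 B
      = scalarMul (Matrix.fromCols (1 : Matrix ι ι ℂ) (0 : Matrix ι κ ℂ))ᴴ A
          (Matrix.fromCols 1 0)
        + scalarMul (Matrix.fromCols (0 : Matrix κ ι ℂ) (1 : Matrix κ κ ℂ))ᴴ B
          (Matrix.fromCols 0 1) := by
    ext i j
    cases i <;> cases j <;> simp [scalarMul, Matrix.one_apply, apply_ite]
  rw [e]
  exact add_mem_cone (conj_mem_cone _ hA) (conj_mem_cone _ hB)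

theorem fromBlocks_neg_mem_cone {A x y B : Matrix ι ι X}
    (h : Matrix.fromBlocks A x y B ∈ cone (ι ⊕ ι)) :
    Matrix.fromBlocks A (-x) (-y) B ∈ cone (ι ⊕ ι) := by
  classical
  have e : Matrix.fromBlocks A (-x) (-y) B
      = scalarMul (Matrix.fromBlocks (1 : Matrix ι ι ℂ) 0 0 (-1))ᴴ (Matrix.fromBlocks A x y B)
          (Matrix.fromBlocks 1 0 0 (-1)) := by
    ext i j
    cases i <;> cases j <;> simp [scalarMul, Matrix.one_apply, apply_ite]
  rw [e]
  exact conj_mem_cone _ h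

/-- The norm of a matrix as a real number. -/
def rnorm (A : Matrix ι ι X) : ℝ := (mnorm A).toReal

theorem rnorm_nonneg (A : Matrix ι ι X) : 0 ≤ rnorm A := ENNReal.toReal_nonneg

theorem ofReal_rnorm (A : Matrix ι ι X) : ENNReal.ofReal (rnorm A) = mnorm A :=
  ENNReal.ofReal_toReal (OperatorSpace.mnorm_ne_top A)

theorem rnorm_zero : rnorm (0 : Matrix ι ι X) = 0 := by
  rw [rnorm, mnorm_zero, ENNReal.toReal_zero]

theorem rnorm_add_le (A B : Matrix ι ι X) : rnorm (A + B) ≤ rnorm A + rnorm B := by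
  rw [rnorm, rnorm, rnorm, ← ENNReal.toReal_add (OperatorSpace.mnorm_ne_top A)
    (OperatorSpace.mnorm_ne_top B)]
  exact ENNReal.toReal_mono (ENNReal.add_ne_top.2 ⟨OperatorSpace.mnorm_ne_top A,
    OperatorSpace.mnorm_ne_top B⟩) (OperatorSpace.mnorm_add_le A B)

theorem rnorm_smul (c : ℂ) (A : Matrix ι ι X) : rnorm (c • A) = ‖c‖ * rnorm A := by
  rw [rnorm, OperatorSpace.mnorm_smul, ENNReal.toReal_mul, toReal_enorm, rnorm]

theorem rnorm_real_smul {r : ℝ} (hr : 0 ≤ r) (A : Matrix ι ι X) : rnorm (r • A) = r * rnorm A := by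
  rw [← Complex.coe_smul, rnorm_smul, Complex.norm_real, Real.norm_of_nonneg hr]

theorem rnorm_neg (A : Matrix ι ι X) : rnorm (-A) = rnorm A := by
  rw [rnorm, mnorm_neg, rnorm]

theorem rnorm_mono {A : Matrix ι ι X} {B : Matrix κ κ X} (h : mnorm A ≤ mnorm B) :
    rnorm A ≤ rnorm B :=
  ENNReal.toReal_mono (OperatorSpace.mnorm_ne_top B) h

theorem rnorm_scalarMul_le (α : Matrix ι κ ℂ) (A : Matrix ι ι X) :
    rnorm (scalarMul αᴴ A α) ≤ opNorm α ^ 2 * rnorm A := by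
  have h := OperatorSpace.mnorm_scalarMul_le αᴴ A α
  rw [opNorm_conjTranspose] at h
  have h2 := ENNReal.toReal_mono (ENNReal.mul_ne_top (ENNReal.mul_ne_top ENNReal.ofReal_ne_top
    (OperatorSpace.mnorm_ne_top A)) ENNReal.ofReal_ne_top) h
  rw [ENNReal.toReal_mul, ENNReal.toReal_mul, ENNReal.toReal_ofReal (opNorm_nonneg α)] at h2
  calc _ ≤ _ := h2
    _ = _ := by rw [rnorm]; ring

theorem rnorm_symPart_le (A : Matrix ι ι X) : rnorm (symPart A) ≤ rnorm A := by
  rw [symPart_apply, rnorm_smul]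
  have h1 := rnorm_add_le A Aᴴ
  have h2 : rnorm Aᴴ = rnorm A := by rw [rnorm, mnorm_conjTranspose, rnorm]
  norm_num
  linarith

theorem enorm_le_of_re_le {G : Matrix ι ι X →ₗ[ℂ] ℂ} {C : ℝ≥0}
    (h : ∀ x, (G x).re ≤ C * rnorm x) (x : Matrix ι ι X) : ‖G x‖ₑ ≤ C * mnorm x := by
  have h1 : ‖G x‖ ≤ C * rnorm x := by
    by_cases hz : G x = 0
    · rw [hz, norm_zero]
      exact mul_nonneg C.coe_nonneg (rnorm_nonneg _)
    · have hn : (‖G x‖ : ℂ) ≠ 0 := by simpa using hz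
      have h2 := h ((star (G x) / ‖G x‖ : ℂ) • x)
      have hc : ‖(star (G x) / ‖G x‖ : ℂ)‖ = 1 := by
        rw [norm_div, norm_star, Complex.norm_real, norm_norm, div_self (by simpa using hz)]
      have e : G ((star (G x) / ‖G x‖ : ℂ) • x) = (‖G x‖ : ℝ) := by
        rw [map_smul, smul_eq_mul, div_mul_eq_mul_div, Complex.star_def, Complex.conj_mul']
        field_simp
      rw [e, rnorm_smul, hc, one_mul, Complex.ofReal_re] at h2
      exact h2
  rw [← ofReal_norm, ← ofReal_rnorm x, ← ENNReal.ofReal_coe_nnreal,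
    ← ENNReal.ofReal_mul C.coe_nonneg]
  exact ENNReal.ofReal_le_ofReal h1

/-- A self-adjoint matrix outside the cone is separated from it by a positive functional. -/
theorem exists_functional_of_notMem {B : Matrix ι ι X} (hB : Bᴴ = B) (hmem : B ∉ cone ι) :
    ∃ G : Matrix ι ι X →ₗ[ℂ] ℂ, (∀ x ∈ cone ι, 0 ≤ G x) ∧ (∀ x, ‖G x‖ₑ ≤ mnorm x) ∧
      (G B).re < 0 := by
  have h0 : ∃ ε : ℝ≥0∞, 0 < ε ∧ ∀ b ∈ cone (V := X) ι, ε ≤ mnorm (B - b) := by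
    by_contra! hcon
    exact hmem (cone_closed B hcon)
  obtain ⟨ε, hε, hεB⟩ := h0
  obtain ⟨δ, hδ0, hδ⟩ := ENNReal.lt_iff_exists_nnreal_btwn.1 hε
  have hδ0 : 0 < (δ : ℝ) := by exact_mod_cast hδ0
  have hδB : ∀ b ∈ cone (V := X) ι, (δ : ℝ) ≤ rnorm (B - b) := by
    intro b hb
    have := ENNReal.toReal_mono (OperatorSpace.mnorm_ne_top _) (hδ.le.trans (hεB b hb))
    rwa [ENNReal.coe_toReal] at this
  -- One cone encodes three demands: `g ≤ ‖·‖` (take `s = 0`, `c = 0`), `g ≥ 0` on the cone (take `x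
  -- = -c`), and `g B ≤ -δ` (take `x = B`, `s = 1`). They are consistent because `B` has distance at
  -- least `δ` from the cone.
  obtain ⟨g, hg⟩ := exists_linearMap_le_of_cone
    (E := Matrix ι ι X)
    (fun x t => ∃ s : ℝ, 0 ≤ s ∧ ∃ c ∈ cone (V := X) ι, rnorm (symPart x + c - s • B) ≤ t + s * δ)
    ⟨0, le_rfl, 0, zero_mem_cone ι, by simp [rnorm_zero]⟩
    (by
      rintro x y t t' ⟨s, hs, c, hc, h⟩ ⟨s', hs', c', hc', h'⟩
      refine ⟨s + s', add_nonneg hs hs', c + c', add_mem_cone hc hc', ?_⟩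
      have e : symPart (x + y) + (c + c') - (s + s') • B
          = (symPart x + c - s • B) + (symPart y + c' - s' • B) := by
        rw [map_add, add_smul]; abel
      rw [e]
      refine (rnorm_add_le _ _).trans ?_
      linarith)
    (by
      rintro x t r hr ⟨s, hs, c, hc, h⟩
      refine ⟨r * s, mul_nonneg hr.le hs, r • c, real_smul_mem_cone hr.le hc, ?_⟩
      have e : symPart (r • x) + r • c - (r * s) • B = r • (symPart x + c - s • B) := by
        rw [map_smul, mul_smul, smul_sub, smul_add]
      rw [e, rnorm_real_smul hr.le]
      have := mul_le_mul_of_nonneg_left h hr.le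
      linarith)
    (fun x => ⟨rnorm (symPart x), 0, le_rfl, 0, zero_mem_cone ι, by simp⟩)
    (by
      rintro t ⟨s, hs, c, hc, h⟩
      rcases hs.eq_or_lt with rfl | hs
      · have := (rnorm_nonneg _).trans h
        simpa using this
      · have h1 := mul_le_mul_of_nonneg_left (hδB (s⁻¹ • c) (real_smul_mem_cone (inv_nonneg.2 hs.le)
          hc)) hs.le
        rw [← rnorm_real_smul hs.le, smul_sub, smul_smul, mul_inv_cancel₀ hs.ne', one_smul,
          ← rnorm_neg, neg_sub] at h1
        rw [map_zero, zero_add] at h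
        linarith)
  have hgc : ∀ c ∈ cone (V := X) ι, 0 ≤ g c := by
    intro c hc
    have h := hg (-c) 0 ⟨0, le_rfl, c, hc, by
      rw [map_neg, symPart_of_isSelfAdjoint (isSelfAdjoint_of_mem hc)]
      simp [rnorm_zero]⟩
    rw [map_neg] at h
    linarith
  have hskew : ∀ x, xᴴ = -x → g x ≤ 0 := fun x hx =>
    hg x 0 ⟨0, le_rfl, 0, zero_mem_cone ι, by rw [symPart_of_skew hx]; simp [rnorm_zero]⟩
  obtain ⟨G, hGre, hGsa⟩ := exists_complex_of_real g fun x hx => by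
    refine le_antisymm (hskew x hx) ?_
    have h := hskew (-x) (by rw [Matrix.conjTranspose_neg, hx])
    rw [map_neg] at h
    linarith
  refine ⟨G, fun x hx => ?_, fun x => ?_, ?_⟩
  · rw [hGsa x (isSelfAdjoint_of_mem hx)]
    exact_mod_cast hgc x hx
  · have := enorm_le_of_re_le (G := G) (C := 1) (fun x => ?_) x
    · simpa using this
    · rw [hGre, NNReal.coe_one, one_mul]
      exact hg x _ ⟨0, le_rfl, 0, zero_mem_cone ι, by simpa using rnorm_symPart_le x⟩
  · rw [hGre]
    have := hg B (-δ) ⟨1, zero_le_one, 0, zero_mem_cone ι, by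
      rw [symPart_of_isSelfAdjoint hB]; simp [rnorm_zero]⟩
    linarith

end Ordered

/-! ### Consequences of matrix regularity and detection of the cones -/

section Regular

variable {X : Type u} [AddCommGroup X] [Module ℂ X] [StarAddMonoid X] [StarModule ℂ X]
  [MatrixNormCone X] [MatrixRegularOperatorSpace X]
variable {ι κ : Type} [Fintype ι] [Fintype κ]

open MatrixOrderedOperatorSpace MatrixRegularOperatorSpace

/-- Changing the sign of the off-diagonal entries preserves positivity, so the off-diagonal part
lies between `± diag(a, b)` and the first regularity axiom applies. -/
theorem mnorm_le_of_fromBlocks_mem_cone {a x y b : Matrix ι ι X}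
    (h : Matrix.fromBlocks a x y b ∈ cone (ι ⊕ ι)) : mnorm x ≤ max (mnorm a) (mnorm b) := by
  have hsa := isSelfAdjoint_of_mem h
  rw [Matrix.fromBlocks_conjTranspose, Matrix.fromBlocks_inj] at hsa
  have ha : a ∈ cone ι := submatrix_mem_cone h Sum.inl
  have hb : b ∈ cone ι := submatrix_mem_cone h Sum.inr
  have h1 := mnorm_le_of_le (Matrix.fromBlocks 0 x y 0) (Matrix.fromBlocks a 0 0 b)
    (by rw [Matrix.fromBlocks_conjTranspose, hsa.2.1, hsa.2.2.1]; simp)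
    (fromBlocks_diag_mem_cone ha hb)
    (by rw [Matrix.fromBlocks_add]; simpa using h)
    (by
      rw [sub_eq_add_neg, Matrix.fromBlocks_neg, Matrix.fromBlocks_add]
      simpa using fromBlocks_neg_mem_cone h)
  rw [OperatorSpace.mnorm_diag, mnorm_offDiag] at h1
  exact (le_max_left _ _).trans h1

/-- The self-adjoint off-diagonal matrix with entries `A`, `A^*` is dominated by some `u`. Averaging
the sum with the difference, after flipping the off-diagonal signs of the latter, removes the
off-diagonal part of `u`. -/
theorem exists_fromBlocks_mem_cone {A : Matrix ι ι X} (hA : mnorm A < 1) :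
    ∃ a b : Matrix ι ι X, mnorm a < 1 ∧ mnorm b < 1 ∧
      Matrix.fromBlocks a A Aᴴ b ∈ cone (ι ⊕ ι) := by
  obtain ⟨u, -, hu1, hu2, hu3⟩ := exists_dominating (Matrix.fromBlocks 0 A Aᴴ 0)
    (by rw [Matrix.fromBlocks_conjTranspose]; simp)
    (by rw [mnorm_offDiag, mnorm_conjTranspose, max_self]; exact hA)
  obtain ⟨a, x, y, b, rfl⟩ : ∃ a x y b, u = Matrix.fromBlocks a x y b :=
    ⟨_, _, _, _, (Matrix.fromBlocks_toBlocks u).symm⟩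
  refine ⟨a, b, ?_, ?_, ?_⟩
  · exact (mnorm_submatrix_le (Matrix.fromBlocks a x y b) Sum.inl_injective
      Sum.inl_injective).trans_lt hu1
  · exact (mnorm_submatrix_le (Matrix.fromBlocks a x y b) Sum.inr_injective
      Sum.inr_injective).trans_lt hu1
  · rw [sub_eq_add_neg, Matrix.fromBlocks_neg, Matrix.fromBlocks_add] at hu3
    rw [Matrix.fromBlocks_add] at hu2
    have h := real_smul_mem_cone (by norm_num : (0 : ℝ) ≤ 2⁻¹)
      (add_mem_cone hu2 (fromBlocks_neg_mem_cone hu3))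
    convert h using 1
    rw [Matrix.fromBlocks_add, Matrix.fromBlocks_smul]
    congr 1
    · rw [neg_zero, add_zero, zero_add, ← two_smul ℝ, smul_smul]; norm_num
    · rw [(by rw [two_smul]; abel : A + x + -(x + -A) = (2 : ℝ) • A), smul_smul]; norm_num
    · rw [(by rw [two_smul]; abel : Aᴴ + y + -(y + -Aᴴ) = (2 : ℝ) • Aᴴ), smul_smul]; norm_num
    · rw [neg_zero, add_zero, zero_add, ← two_smul ℝ, smul_smul]; norm_num

theorem eq_zero_of_mem_cone_of_neg_mem_cone {x : Matrix ι ι X} (h : x ∈ cone ι)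
    (h' : -x ∈ cone ι) : x = 0 := by
  refine OperatorSpace.eq_zero_of_mnorm x (le_antisymm ?_ zero_le)
  have := mnorm_le_of_le x 0 (isSelfAdjoint_of_mem h) (zero_mem_cone ι) (by simpa) (by simpa)
  rwa [mnorm_zero] at this

theorem exists_mem_cone_sub_eq {x : Matrix ι ι X} (hx : xᴴ = x) :
    ∃ a ∈ cone (V := X) ι, ∃ b ∈ cone (V := X) ι, x = a - b := by
  set r : ℝ := rnorm x + 1 with hr
  have hr0 : 0 < r := add_pos_of_nonneg_of_pos (rnorm_nonneg _) one_pos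
  have h1 : mnorm (r⁻¹ • x) < 1 := by
    rw [← ofReal_rnorm, rnorm_real_smul (inv_pos.2 hr0).le, ENNReal.ofReal_lt_one,
      inv_mul_lt_one₀ hr0]
    linarith
  obtain ⟨u, hu, -, h2, -⟩ := exists_dominating (r⁻¹ • x)
    (by rw [Matrix.conjTranspose_smul, hx]; simp) h1
  refine ⟨r • (r⁻¹ • x + u), real_smul_mem_cone hr0.le h2, r • u, real_smul_mem_cone hr0.le hu, ?_⟩
  rw [smul_add, smul_smul, mul_inv_cancel₀ hr0.ne', one_smul, add_sub_cancel_right]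

/-- Completely positive maps into scalar matrices are hermitian. -/
theorem IsCP.map_conjTranspose {ψ : X →ₗ[ℂ] Matrix κ κ ℂ} (hψ : IsCP ψ) (A : Matrix ι ι X) :
    Matrix.comp ι ι κ κ ℂ (Aᴴ.map ψ) = (Matrix.comp ι ι κ κ ℂ (A.map ψ))ᴴ := by
  have hpos : ∀ x ∈ cone (V := X) ι, (Matrix.comp ι ι κ κ ℂ (x.map ψ))ᴴ
      = Matrix.comp ι ι κ κ ℂ (x.map ψ) := fun x hx =>
    (show (Matrix.comp ι ι κ κ ℂ (x.map ψ)).PosSemidef from hψ ι x hx).1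
  let L : Matrix ι ι X →+ Matrix (ι × κ) (ι × κ) ℂ :=
    { toFun := fun x => Matrix.comp ι ι κ κ ℂ (x.map ψ)
      map_zero' := by ext; simp
      map_add' := fun x y => by ext; simp }
  have hLs : ∀ (c : ℂ) x, L (c • x) = c • L x := fun c x => by ext; simp [L]
  have hsa : ∀ x : Matrix ι ι X, xᴴ = x → (L x)ᴴ = L x := by
    intro x hx
    obtain ⟨a, ha, b, hb, rfl⟩ := exists_mem_cone_sub_eq hx
    rw [map_sub, Matrix.conjTranspose_sub]
    exact congrArg₂ _ (hpos a ha) (hpos b hb)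
  change L Aᴴ = (L A)ᴴ
  have h1 := hsa (A + Aᴴ) (by simp [add_comm])
  have h2 := hsa (Complex.I • (A - Aᴴ)) (by simp [Matrix.conjTranspose_smul, ← smul_neg])
  rw [map_add, Matrix.conjTranspose_add] at h1
  rw [hLs, map_sub, Matrix.conjTranspose_smul, Matrix.conjTranspose_sub, Complex.star_def,
    Complex.conj_I, neg_smul, ← smul_neg] at h2
  have h3 := smul_right_injective _ Complex.I_ne_zero h2
  rw [neg_sub] at h3
  have h4 : (2 : ℂ) • L Aᴴ = (2 : ℂ) • (L A)ᴴ := by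
    rw [two_smul, two_smul]
    have e1 : L Aᴴ = (L A)ᴴ + (L Aᴴ)ᴴ - L A := by rw [h1]; abel
    have e2 : L Aᴴ = (L A) - ((L Aᴴ)ᴴ - (L A)ᴴ) := by rw [h3]; abel
    calc L Aᴴ + L Aᴴ = ((L A)ᴴ + (L Aᴴ)ᴴ - L A) + ((L A) - ((L Aᴴ)ᴴ - (L A)ᴴ)) := by
          rw [← e1, ← e2]
      _ = _ := by abel
  exact smul_right_injective _ (two_ne_zero) h4

/-- The cones of a matrix regular operator space are determined by the completely positive
completely bounded maps into matrix algebras. -/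
theorem mem_cone_of_forall_isCP {B : Matrix ι ι X}
    (h : ∀ (κ : Type) [Fintype κ] (ψ : X →ₗ[ℂ] Matrix κ κ ℂ), IsCP ψ → cbNorm ψ ≠ ∞ →
      B.map ψ ∈ cone ι) : B ∈ cone ι := by
  classical
  have key : ∀ x : Matrix ι ι X, xᴴ = x → (∀ ψ : X →ₗ[ℂ] Matrix ι ι ℂ, IsCP ψ → cbNorm ψ ≠ ∞ →
      (Matrix.comp ι ι ι ι ℂ (x.map ψ)).PosSemidef) → x ∈ cone ι := by
    intro x hx hpos
    by_contra hmem
    obtain ⟨G, hG0, hG1, hGx⟩ := exists_functional_of_notMem hx hmem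
    have h1 : IsCP (functionalMap G) := isCP_functionalMap fun ι _ A hA α =>
      hG0 _ (conj_mem_cone _ hA)
    have h2 : cbNorm (functionalMap G) ≤ (1 : ℝ≥0) :=
      cbNorm_functionalMap_le fun x => by simpa using hG1 x
    -- The identity matrix, read as a vector, makes the quadratic form return `G x`.
    have h3 := (hpos _ h1 (h2.trans_lt ENNReal.coe_lt_top).ne).dotProduct_mulVec_nonneg
      (fun p => (1 : Matrix ι ι ℂ) p.1 p.2)
    rw [functionalMap_dotProduct] at h3
    have e : (Matrix.of fun k i => (1 : Matrix ι ι ℂ) k i) = 1 := rfl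
    simp only [e, Matrix.conjTranspose_one, scalarMul_one] at h3
    exact absurd (Complex.nonneg_iff.1 h3).1 (not_le.2 hGx)
  have hB : ∀ ψ : X →ₗ[ℂ] Matrix ι ι ℂ, IsCP ψ → cbNorm ψ ≠ ∞ →
      (Matrix.comp ι ι ι ι ℂ (B.map ψ)).PosSemidef := fun ψ h1 h2 => h ι ψ h1 h2
  -- `B` is not assumed self-adjoint. Every `ψ` kills `B - B^*`, so both `± i(B - B^*)` lie in the
  -- cone, which forces `B = B^*`.
  have hI : ∀ ψ : X →ₗ[ℂ] Matrix ι ι ℂ, IsCP ψ → cbNorm ψ ≠ ∞ → ∀ c : ℂ,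
      Matrix.comp ι ι ι ι ℂ ((c • (B - Bᴴ)).map ψ) = 0 := by
    intro ψ h1 h2 c
    have e : Matrix.comp ι ι ι ι ℂ ((c • (B - Bᴴ)).map ψ)
        = c • (Matrix.comp ι ι ι ι ℂ (B.map ψ) - Matrix.comp ι ι ι ι ℂ (Bᴴ.map ψ)) := by
      ext; simp
    rw [e, h1.map_conjTranspose, (hB ψ h1 h2).1, sub_self, smul_zero]
  have hsa : ∀ c : ℂ, star c = -c → (c • (B - Bᴴ))ᴴ = c • (B - Bᴴ) := fun c hc => by
    rw [Matrix.conjTranspose_smul, hc, Matrix.conjTranspose_sub, Matrix.conjTranspose_conjTranspose,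
      neg_smul, ← smul_neg, neg_sub]
  have h1 := key (Complex.I • (B - Bᴴ)) (hsa _ (by simp)) fun ψ h1 h2 => by
    rw [hI ψ h1 h2]; exact Matrix.PosSemidef.zero
  have h2 := key ((-Complex.I) • (B - Bᴴ)) (hsa _ (by simp)) fun ψ h1 h2 => by
    rw [hI ψ h1 h2]; exact Matrix.PosSemidef.zero
  rw [neg_smul] at h2
  have h3 := eq_zero_of_mem_cone_of_neg_mem_cone h1 h2
  rw [smul_eq_zero_iff_right Complex.I_ne_zero, sub_eq_zero] at h3
  exact key B h3.symm hB

end Regular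

/-! ### A norming positive functional dominated by a state-like functional on matrices -/

section Detection

variable {X : Type u} [AddCommGroup X] [Module ℂ X] [StarAddMonoid X] [StarModule ℂ X]
  [MatrixNormCone X] [MatrixRegularOperatorSpace X]
variable {ι κ : Type} [Fintype ι] [Fintype κ]

open MatrixOrderedOperatorSpace MatrixRegularOperatorSpace

theorem opNorm_sq_le_of_posSemidef [DecidableEq κ] {α : Matrix ι κ ℂ} {r : ℝ} (hr : 0 ≤ r)
    (h : ((r : ℂ) • (1 : Matrix κ κ ℂ) - αᴴ * α).PosSemidef) : opNorm α ^ 2 ≤ r := by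
  have h1 : opNorm α ≤ √r := by
    refine opNorm_le_of_forall (Real.sqrt_nonneg r) fun η ξ => ?_
    have h2 := (Complex.nonneg_iff.1 (h.dotProduct_mulVec_nonneg ξ)).1
    rw [Matrix.sub_mulVec, dotProduct_sub, Matrix.smul_mulVec, Matrix.one_mulVec,
      dotProduct_smul, star_dotProduct_self, ← Matrix.mulVec_mulVec, Matrix.dotProduct_mulVec,
      ← Matrix.star_mulVec, star_dotProduct_self, smul_eq_mul, ← Complex.ofReal_mul,
      ← Complex.ofReal_sub, Complex.ofReal_re, sub_nonneg] at h2
    have h3 : l2Norm (α *ᵥ ξ) ≤ √r * l2Norm ξ := by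
      refine abs_le_of_sq_le_sq' ?_ (mul_nonneg (Real.sqrt_nonneg _) (l2Norm_nonneg _)) |>.2
      rwa [mul_pow, Real.sq_sqrt hr]
    refine (norm_star_dotProduct_le _ _).trans ?_
    have := mul_le_mul_of_nonneg_left h3 (l2Norm_nonneg η)
    linarith
  calc opNorm α ^ 2 ≤ √r ^ 2 := pow_le_pow_left₀ (opNorm_nonneg _) h1 2
    _ = r := Real.sq_sqrt hr

/-- The convex cone whose separating functionals are pairs `(G, P)` as in
`exists_functional_pair`. -/
def DominationCone [DecidableEq κ] (B : Matrix κ κ X) (p : Matrix κ κ X × Matrix κ κ ℂ) (t : ℝ) :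
    Prop :=
  ∃ (ι : Type) (_ : Fintype ι) (w : Matrix ι ι X) (α : Matrix ι κ ℂ) (s r : ℝ),
    w ∈ cone ι ∧ mnorm w ≤ 1 ∧ 0 ≤ s ∧ 0 ≤ r ∧
    scalarMul αᴴ w α - symPart p.1 - s • B ∈ cone κ ∧
    ((r : ℂ) • (1 : Matrix κ κ ℂ) - αᴴ * α - symPart p.2).PosSemidef ∧
    r - s * rnorm B ≤ t

/-- The decisive condition is nonnegativity over the origin: `s B ≤ α^* w α` and `α^* α ≤ r` give `s
‖B‖ ≤ ‖α‖² ‖w‖ ≤ r` by monotonicity of the norm. Sums stay in the cone by stacking the `α` and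
taking the direct sum of the `w`. This is why `ι` is left free. -/
theorem exists_linearMap_le_of_dominationCone [DecidableEq κ] {B : Matrix κ κ X}
    (hB : B ∈ cone κ) :
    ∃ g : Matrix κ κ X × Matrix κ κ ℂ →ₗ[ℝ] ℝ, ∀ p t, DominationCone B p t → g p ≤ t := by
  refine exists_linearMap_le_of_cone (DominationCone B) ?_ ?_ ?_ ?_ ?_
  · refine ⟨κ, _, 0, 0, 0, 0, zero_mem_cone κ, by simp [mnorm_zero], le_rfl, le_rfl, ?_, ?_, by simp⟩
    · have e : scalarMul (0 : Matrix κ κ ℂ)ᴴ (0 : Matrix κ κ X) 0 = 0 := by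
        ext i j; simp [scalarMul]
      rw [e]
      simpa using zero_mem_cone κ
    · simpa using Matrix.PosSemidef.zero
  · rintro ⟨x, y⟩ ⟨x', y'⟩ t t' ⟨ι, _, w, α, s, r, hw, hw1, hs, hr, h1, h2, h3⟩
      ⟨ι', _, w', α', s', r', hw', hw1', hs', hr', h1', h2', h3'⟩
    refine ⟨ι ⊕ ι', inferInstance, Matrix.fromBlocks w 0 0 w', Matrix.fromRows α α', s + s', r + r',
      fromBlocks_diag_mem_cone hw hw', ?_, add_nonneg hs hs', add_nonneg hr hr', ?_, ?_, ?_⟩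
    · rw [OperatorSpace.mnorm_diag]
      exact max_le hw1 hw1'
    · rw [scalarMul_fromRows]
      convert add_mem_cone h1 h1' using 1
      simp only [Prod.mk_add_mk, map_add, add_smul]
      abel
    · convert h2.add h2' using 1
      simp only [Prod.mk_add_mk, map_add, Complex.ofReal_add, add_smul,
        Matrix.conjTranspose_fromRows_eq_fromCols_conjTranspose, Matrix.fromCols_mul_fromRows]
      abel
    · linarith
  · rintro ⟨x, y⟩ t c hc ⟨ι, _, w, α, s, r, hw, hw1, hs, hr, h1, h2, h3⟩
    -- `α` enters quadratically, so scaling by `c` uses `√c`.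
    have hsq : (((√c : ℝ) : ℂ)) * ((√c : ℝ) : ℂ) = (c : ℂ) := by
      rw [← Complex.ofReal_mul, Real.mul_self_sqrt hc.le]
    refine ⟨ι, _, w, ((√c : ℝ) : ℂ) • α, c * s, c * r, hw, hw1, mul_nonneg hc.le hs,
      mul_nonneg hc.le hr, ?_, ?_, ?_⟩
    · convert real_smul_mem_cone hc.le h1 using 1
      rw [Matrix.conjTranspose_smul, Complex.star_def, Complex.conj_ofReal, smul_scalarMul_smul, hsq,
        Complex.coe_smul, Prod.smul_mk, map_smul, mul_smul, smul_sub, smul_sub]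
    · convert h2.smul (show (0 : ℂ) ≤ c by exact_mod_cast hc.le) using 1
      rw [Matrix.conjTranspose_smul, Complex.star_def, Complex.conj_ofReal, Matrix.smul_mul,
        Matrix.mul_smul, smul_smul, hsq, Prod.smul_mk, map_smul, Complex.ofReal_mul, mul_smul,
        smul_sub, smul_sub, Complex.coe_smul c (symPart _)]
    · have := mul_le_mul_of_nonneg_left h3 hc.le
      linarith
  · rintro ⟨x, y⟩
    set μ : ℝ := rnorm (symPart x) + 1 with hμ
    have hμ0 : 0 < μ := add_pos_of_nonneg_of_pos (rnorm_nonneg _) one_pos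
    -- The `X`-component is absorbed by `w = u` and `α = √μ · 1`. With `r = μ + ‖sym y‖`, what
    -- remains in the scalar component is `‖sym y‖ - sym y ≥ 0`.
    obtain ⟨u, hu, hu1, -, hu2⟩ := exists_dominating (μ⁻¹ • symPart x)
      (by rw [Matrix.conjTranspose_smul, conjTranspose_symPart]; simp)
      (by
        rw [← ofReal_rnorm, rnorm_real_smul (inv_pos.2 hμ0).le, ENNReal.ofReal_lt_one,
          inv_mul_lt_one₀ hμ0]
        linarith)
    have hsq : (((√μ : ℝ) : ℂ)) * ((√μ : ℝ) : ℂ) = (μ : ℂ) := by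
      rw [← Complex.ofReal_mul, Real.mul_self_sqrt hμ0.le]
    refine ⟨μ + opNorm (symPart y), κ, _, u, ((√μ : ℝ) : ℂ) • 1, 0, μ + opNorm (symPart y), hu,
      hu1.le, le_rfl, add_nonneg hμ0.le (opNorm_nonneg _), ?_, ?_, by simp⟩
    · convert real_smul_mem_cone hμ0.le hu2 using 1
      rw [Matrix.conjTranspose_smul, Complex.star_def, Complex.conj_ofReal, smul_scalarMul_smul, hsq,
        Matrix.conjTranspose_one, scalarMul_one, zero_smul, sub_zero, smul_sub, smul_smul,
        mul_inv_cancel₀ hμ0.ne', one_smul, Complex.coe_smul]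
    · convert posSemidef_smul_one_sub (conjTranspose_symPart y) le_rfl using 1
      rw [Matrix.conjTranspose_smul, Complex.star_def, Complex.conj_ofReal, Matrix.smul_mul,
        Matrix.mul_smul, smul_smul, hsq, Matrix.conjTranspose_one, mul_one, Complex.ofReal_add,
        add_smul, add_sub_cancel_left]
  · rintro t ⟨ι, _, w, α, s, r, hw, hw1, hs, hr, h1, h2, h3⟩
    simp only [Prod.fst_zero, Prod.snd_zero, map_zero, sub_zero] at h1 h2
    have hsB : s • B ∈ cone κ := real_smul_mem_cone hs hB
    have hα := conj_mem_cone α hw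
    have h4 := rnorm_mono (mnorm_le_of_le (s • B) (scalarMul αᴴ w α) (isSelfAdjoint_of_mem hsB)
      hα (add_mem_cone hsB hα) h1)
    rw [rnorm_real_smul hs] at h4
    have h5 := rnorm_scalarMul_le α w
    have h6 : rnorm w ≤ 1 := ENNReal.toReal_le_of_le_ofReal zero_le_one (by simpa using hw1)
    have h7 := opNorm_sq_le_of_posSemidef hr h2
    have h8 := mul_le_mul_of_nonneg_left h6 (sq_nonneg (opNorm α))
    linarith

/-- `G` norms `B`, and `P` controls `G` on all compressions of positive contractions. A bound on
`‖G‖` alone would not suffice: recovering `G B` from the associated map by the identity vector costs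
the factor `|κ|`, while the density matrix of `P` supplies a vector of the right length. Each
property comes from one test element of the cone. -/
theorem exists_functional_pair [DecidableEq κ] {B : Matrix κ κ X} (hB : B ∈ cone κ) :
    ∃ (G : Matrix κ κ X →ₗ[ℂ] ℂ) (P : Matrix κ κ ℂ →ₗ[ℂ] ℂ),
      (∀ x ∈ cone κ, 0 ≤ G x) ∧ (∀ y : Matrix κ κ ℂ, y.PosSemidef → 0 ≤ P y) ∧
      (P 1).re ≤ 1 ∧ rnorm B ≤ (G B).re ∧
      ∀ (ι : Type) [Fintype ι] (w : Matrix ι ι X) (α : Matrix ι κ ℂ), w ∈ cone ι → mnorm w ≤ 1 →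
        (G (scalarMul αᴴ w α)).re ≤ (P (αᴴ * α)).re := by
  obtain ⟨g, hg⟩ := exists_linearMap_le_of_dominationCone hB
  have hs0 : scalarMul (0 : Matrix κ κ ℂ)ᴴ (0 : Matrix κ κ X) 0 = 0 := by
    ext i j; simp [scalarMul]
  have hskew1 : ∀ x, xᴴ = -x → g (x, 0) ≤ 0 := fun x hx => hg _ 0
    ⟨κ, _, 0, 0, 0, 0, zero_mem_cone κ, by simp [mnorm_zero], le_rfl, le_rfl, by
      rw [hs0, symPart_of_skew hx]; simpa using zero_mem_cone κ, by
      simpa using Matrix.PosSemidef.zero, by simp⟩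
  have hskew2 : ∀ y, yᴴ = -y → g (0, y) ≤ 0 := fun y hy => hg _ 0
    ⟨κ, _, 0, 0, 0, 0, zero_mem_cone κ, by simp [mnorm_zero], le_rfl, le_rfl, by
      rw [hs0]; simpa using zero_mem_cone κ, by
      rw [symPart_of_skew hy]; simpa using Matrix.PosSemidef.zero, by simp⟩
  obtain ⟨G, hG, hGsa⟩ := exists_complex_of_real (g ∘ₗ LinearMap.inl ℝ _ _) fun x hx => by
    refine le_antisymm (hskew1 x hx) ?_
    have h := hskew1 (-x) (by rw [Matrix.conjTranspose_neg, hx])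
    have e : ((-x, 0) : Matrix κ κ X × Matrix κ κ ℂ) = -(x, 0) := by simp
    rw [e, map_neg] at h
    exact neg_nonpos.1 h
  obtain ⟨P, hP, hPsa⟩ := exists_complex_of_real (g ∘ₗ LinearMap.inr ℝ _ _) fun x hx => by
    refine le_antisymm (hskew2 x hx) ?_
    have h := hskew2 (-x) (by rw [Matrix.conjTranspose_neg, hx])
    have e : ((0, -x) : Matrix κ κ X × Matrix κ κ ℂ) = -(0, x) := by simp
    rw [e, map_neg] at h
    exact neg_nonpos.1 h
  refine ⟨G, P, fun x hx => ?_, fun y hy => ?_, ?_, ?_, fun ι _ w α hw hw1 => ?_⟩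
  · rw [hGsa x (isSelfAdjoint_of_mem hx)]
    have h := hg (-x, 0) 0 ⟨κ, _, 0, 0, 0, 0, zero_mem_cone κ, by simp [mnorm_zero], le_rfl, le_rfl,
      by
        rw [hs0, map_neg, symPart_of_isSelfAdjoint (isSelfAdjoint_of_mem hx)]; simpa using hx,
      by simpa using Matrix.PosSemidef.zero, by simp⟩
    have e : ((-x, 0) : Matrix κ κ X × Matrix κ κ ℂ) = -(x, 0) := by simp
    rw [e, map_neg] at h
    exact Complex.zero_le_real.2 (neg_nonpos.1 h)
  · rw [hPsa y hy.1]
    have h := hg (0, -y) 0 ⟨κ, _, 0, 0, 0, 0, zero_mem_cone κ, by simp [mnorm_zero], le_rfl, le_rfl,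
      by rw [hs0]; simpa using zero_mem_cone κ,
      by rw [map_neg, symPart_of_isSelfAdjoint hy.1]; simpa using hy, by simp⟩
    have e : ((0, -y) : Matrix κ κ X × Matrix κ κ ℂ) = -(0, y) := by simp
    rw [e, map_neg] at h
    exact Complex.zero_le_real.2 (neg_nonpos.1 h)
  · rw [hP]
    exact hg (0, 1) 1 ⟨κ, _, 0, 0, 0, 1, zero_mem_cone κ, by simp [mnorm_zero], le_rfl, zero_le_one,
      by rw [hs0]; simpa using zero_mem_cone κ,
      by rw [symPart_of_isSelfAdjoint Matrix.conjTranspose_one]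
         simpa using Matrix.PosSemidef.zero, by simp⟩
  · rw [hG]
    have h := hg (-B, 0) (-rnorm B) ⟨κ, _, 0, 0, 1, 0, zero_mem_cone κ, by simp [mnorm_zero],
      zero_le_one, le_rfl,
      by
        rw [hs0, map_neg, symPart_of_isSelfAdjoint (isSelfAdjoint_of_mem hB)]
        simpa using zero_mem_cone κ,
      by simpa using Matrix.PosSemidef.zero, by simp⟩
    have e : ((-B, 0) : Matrix κ κ X × Matrix κ κ ℂ) = -(B, 0) := by simp
    rw [e, map_neg] at h
    exact neg_le_neg_iff.1 h
  · rw [hG, hP]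
    have h := hg (scalarMul αᴴ w α, -(αᴴ * α)) 0 ⟨ι, _, w, α, 0, 0, hw, hw1, le_rfl, le_rfl,
      by
        rw [symPart_of_isSelfAdjoint (isSelfAdjoint_of_mem (conj_mem_cone α hw))]
        simpa using zero_mem_cone κ,
      by
        rw [map_neg, symPart_of_isSelfAdjoint (Matrix.isHermitian_conjTranspose_mul_self α)]
        simpa using Matrix.PosSemidef.zero, by simp⟩
    have e : ((scalarMul αᴴ w α, -(αᴴ * α)) : Matrix κ κ X × Matrix κ κ ℂ)
        = (scalarMul αᴴ w α, 0) - (0, αᴴ * α) := by simp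
    rw [e, map_sub] at h
    exact sub_nonpos.1 h

end Detection

/-! ### Norms of positive matrices and of completely positive maps -/

section CompletelyPositive

variable {X : Type u} [AddCommGroup X] [Module ℂ X] [StarAddMonoid X] [StarModule ℂ X]
  [MatrixNormCone X] [MatrixRegularOperatorSpace X]
variable {Y : Type v} [AddCommGroup Y] [Module ℂ Y] [StarAddMonoid Y] [StarModule ℂ Y]
  [MatrixNormCone Y] [MatrixRegularOperatorSpace Y]
variable {ι κ : Type} [Fintype ι] [Fintype κ]

open MatrixOrderedOperatorSpace MatrixRegularOperatorSpace

theorem comp_fromBlocks_map {Z : Type*} (T : X → Matrix κ κ Z) (a x y b : Matrix ι ι X) :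
    (Matrix.comp _ _ κ κ Z ((Matrix.fromBlocks a x y b).map T)).submatrix
        (Equiv.sumProdDistrib ι ι κ).symm (Equiv.sumProdDistrib ι ι κ).symm
      = Matrix.fromBlocks (Matrix.comp _ _ κ κ Z (a.map T)) (Matrix.comp _ _ κ κ Z (x.map T))
          (Matrix.comp _ _ κ κ Z (y.map T)) (Matrix.comp _ _ κ κ Z (b.map T)) := by
  ext i j
  cases i <;> cases j <;> rfl

/-- The trace of `α^* α` is the squared length of the reshaped vector, so the trace bound says that
positive contractions go below `1`. A general matrix of norm `< 1` is a corner of a positive block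
with such diagonal entries. -/
theorem isCompleteContraction_functionalMap {G : Matrix κ κ X →ₗ[ℂ] ℂ}
    (h0 : ∀ x ∈ cone κ, 0 ≤ G x)
    (h1 : ∀ (ι : Type) [Fintype ι] (A : Matrix ι ι X) (α : Matrix ι κ ℂ), A ∈ cone ι →
      mnorm A ≤ 1 → (G (scalarMul αᴴ A α)).re ≤ (αᴴ * α).trace.re) :
    IsCompleteContraction (functionalMap G) := by
  classical
  refine isCompleteContraction_iff.2 (cbNorm_le_of_forall_lt_one fun ι _ A hA => ?_)
  obtain ⟨a, b, ha1, hb1, hab⟩ := exists_fromBlocks_mem_cone hA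
  have ha : a ∈ cone ι := submatrix_mem_cone hab Sum.inl
  have hb : b ∈ cone ι := submatrix_mem_cone hab Sum.inr
  have hCP : IsCP (functionalMap G) := isCP_functionalMap fun ι _ A hA α =>
    h0 _ (conj_mem_cone α hA)
  have hle : ∀ c ∈ cone (V := X) ι, mnorm c ≤ 1 →
      (1 - Matrix.comp ι ι κ κ ℂ (c.map (functionalMap G))).PosSemidef := by
    intro c hc hc1
    refine posSemidef_of_forall fun ξ => ?_
    rw [Matrix.sub_mulVec, dotProduct_sub, Matrix.one_mulVec, functionalMap_dotProduct, sub_nonneg]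
    set α : Matrix ι κ ℂ := Matrix.of fun k i => ξ (k, i) with hα
    have h2 := Complex.nonneg_iff.1 (h0 _ (conj_mem_cone α hc))
    have h3 : (αᴴ * α).trace = star ξ ⬝ᵥ ξ := by
      rw [Matrix.trace, dotProduct, Fintype.sum_prod_type_right]
      rfl
    have h4 := h1 ι c α hc hc1
    rw [h3, star_dotProduct_self] at h4
    rw [star_dotProduct_self, Complex.le_def]
    exact ⟨h4, h2.2.symm.trans (Complex.ofReal_im _).symm⟩
  have h5 : (Matrix.comp _ _ κ κ ℂ ((Matrix.fromBlocks a A Aᴴ b).map (functionalMap G))).PosSemidef :=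
    hCP _ _ hab
  have h6 := h5.submatrix (Equiv.sumProdDistrib ι ι κ).symm
  rw [comp_fromBlocks_map] at h6
  have h7 := opNorm_le_one_of_fromBlocks h6 (hle a ha ha1.le) (hle b hb hb1.le)
  exact ENNReal.ofReal_le_one.2 h7

theorem exists_trace_eq [DecidableEq κ] (P : Matrix κ κ ℂ →ₗ[ℂ] ℂ) :
    ∃ ρ : Matrix κ κ ℂ, ∀ y, P y = (y * ρ).trace := by
  refine ⟨Matrix.of fun j i => P (Matrix.single i j 1), fun y => ?_⟩
  conv_lhs => rw [Matrix.matrix_eq_sum_single y]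
  simp only [map_sum, Matrix.trace, Matrix.diag_apply, Matrix.mul_apply, Matrix.of_apply]
  refine Finset.sum_congr rfl fun i _ => Finset.sum_congr rfl fun j _ => ?_
  rw [← smul_eq_mul, ← map_smul, Matrix.smul_single, smul_eq_mul, mul_one]

theorem trace_conjTranspose_mul_self_re (α : Matrix ι κ ℂ) :
    (αᴴ * α).trace.re = l2Norm (fun p : ι × κ => α p.1 p.2) ^ 2 := by
  have h : (αᴴ * α).trace = star (fun p : ι × κ => α p.1 p.2) ⬝ᵥ fun p : ι × κ => α p.1 p.2 := by
    rw [Matrix.trace, dotProduct, Fintype.sum_prod_type_right]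
    rfl
  rw [h, star_dotProduct_self, Complex.ofReal_re]

/-- The norm of a positive matrix over a matrix regular operator space is determined by the
completely positive complete contractions into matrix algebras. -/
theorem mnorm_le_of_forall_isCP {B : Matrix κ κ X} (hB : B ∈ cone κ) {D : ℝ≥0∞}
    (h : ∀ ψ : X →ₗ[ℂ] Matrix κ κ ℂ, IsCP ψ → IsCompleteContraction ψ → mnorm (B.map ψ) ≤ D) :
    mnorm B ≤ D := by
  classical
  rcases eq_or_ne D ∞ with rfl | hD
  · exact le_top
  obtain ⟨G, P, hG, hP, hP1, hGB, hGP⟩ := exists_functional_pair hB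
  obtain ⟨ρ, hρ⟩ := exists_trace_eq P
  have hρ0 : ρ.PosSemidef := by
    refine posSemidef_of_forall fun ξ => ?_
    have h1 := hP _ (Matrix.posSemidef_vecMulVec_self_star ξ)
    rwa [hρ, Matrix.trace_mul_comm, Matrix.mul_vecMulVec, Matrix.trace_vecMulVec,
      dotProduct_comm] at h1
  have key : ∀ ε : ℝ, 0 < ε → rnorm B ≤ D.toReal * (1 + ε * Fintype.card κ) := by
    intro ε hε
    have hεC : (0 : ℂ) < ε := by exact_mod_cast hε
    -- The density matrix may be singular; adding `ε` makes its square root-like factor `s`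
    -- invertible.
    have hρ' : (ρ + (ε : ℂ) • 1).PosDef := Matrix.PosDef.posSemidef_add hρ0 (Matrix.PosDef.one.smul hεC)
    obtain ⟨s, hs⟩ : ∃ s : Matrix κ κ ℂ, ρ + (ε : ℂ) • 1 = sᴴ * s := by
      open scoped MatrixOrder in
      exact CStarAlgebra.nonneg_iff_eq_star_mul_self.1 hρ'.posSemidef.nonneg
    have hsdet : IsUnit s.det := by
      have := (Matrix.isUnit_iff_isUnit_det _).1 hρ'.isUnit
      rw [hs, Matrix.det_mul] at this
      exact isUnit_of_mul_isUnit_right this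
    have hsdet' : IsUnit sᴴ.det := by
      rw [Matrix.det_conjTranspose]; exact hsdet.star
    set τ : Matrix κ κ ℂ := (sᴴ)⁻¹ with hτ
    have hτH : τᴴ = s⁻¹ := by
      rw [hτ, Matrix.conjTranspose_nonsing_inv, Matrix.conjTranspose_conjTranspose]
    let G' : Matrix κ κ X →ₗ[ℂ] ℂ :=
      { toFun := fun x => G (scalarMul τᴴ x τ)
        map_add' := fun x y => by rw [scalarMul_add, map_add]
        map_smul' := fun c x => by rw [scalarMul_smul, map_smul]; rfl }
    have hG' : ∀ x, G' x = G (scalarMul τᴴ x τ) := fun _ => rfl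
    have hG'0 : ∀ x ∈ cone κ, 0 ≤ G' x := fun x hx => hG _ (conj_mem_cone τ hx)
    have hcc : IsCompleteContraction (functionalMap G') := by
      refine isCompleteContraction_functionalMap hG'0 fun ι _ A α hA hA1 => ?_
      rw [hG', scalarMul_scalarMul, ← Matrix.conjTranspose_mul]
      refine (hGP ι A (α * τ) hA hA1).trans ?_
      -- Twisting by `τ = (s^*)⁻¹` replaces `P` by the trace, up to a nonnegative `ε` term, because
      -- `τ (ρ + ε) τ^* = 1`.
      have e : (αᴴ * α).trace = P ((α * τ)ᴴ * (α * τ)) + ε * ((α * τ)ᴴ * (α * τ)).trace := by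
        have e1 : τ * (ρ + (ε : ℂ) • 1) * τᴴ = 1 := by
          rw [hs, hτH, hτ, ← mul_assoc, Matrix.nonsing_inv_mul _ hsdet', one_mul,
            Matrix.mul_nonsing_inv _ hsdet]
        have e2 : P ((α * τ)ᴴ * (α * τ)) + ε * ((α * τ)ᴴ * (α * τ)).trace
            = ((α * τ)ᴴ * (α * τ) * (ρ + (ε : ℂ) • 1)).trace := by
          rw [hρ, mul_add, Matrix.trace_add, Matrix.mul_smul, mul_one, Matrix.trace_smul,
            smul_eq_mul]
        rw [Matrix.mul_assoc] at e1
        rw [e2, Matrix.conjTranspose_mul, Matrix.mul_assoc, Matrix.mul_assoc,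
          Matrix.trace_mul_comm τᴴ]
        simp only [Matrix.mul_assoc]
        rw [e1, Matrix.mul_one]
      rw [e, Complex.add_re, Complex.re_ofReal_mul, trace_conjTranspose_mul_self_re]
      have := mul_nonneg hε.le (sq_nonneg (l2Norm (fun p : ι × κ => (α * τ) p.1 p.2)))
      linarith
    have hCP : IsCP (functionalMap G') := isCP_functionalMap fun ι _ A hA α =>
      hG'0 _ (conj_mem_cone α hA)
    have h1 : opNorm (Matrix.comp κ κ κ κ ℂ (B.map (functionalMap G'))) ≤ D.toReal :=
      (ENNReal.ofReal_le_iff_le_toReal hD).1 (h _ hCP hcc)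
    -- The vector given by `s^*` undoes the twist and returns `G B`. Its squared length is `tr ρ + ε
    -- |κ| ≤ 1 + ε |κ|`.
    have h2 := norm_dotProduct_mulVec_le (Matrix.comp κ κ κ κ ℂ (B.map (functionalMap G')))
      (fun p => sᴴ p.1 p.2) (fun p => sᴴ p.1 p.2)
    rw [functionalMap_dotProduct] at h2
    have e3 : (Matrix.of fun k i => sᴴ k i) = sᴴ := rfl
    simp only [e3] at h2
    rw [hG', scalarMul_scalarMul, ← Matrix.conjTranspose_mul, hτ, Matrix.mul_nonsing_inv _ hsdet',
      Matrix.conjTranspose_one, scalarMul_one, ← sq, ← trace_conjTranspose_mul_self_re,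
      Matrix.conjTranspose_conjTranspose, Matrix.trace_mul_comm, ← hs, Matrix.trace_add,
      Matrix.trace_smul, Matrix.trace_one, Complex.add_re] at h2
    have h3 : ρ.trace.re ≤ 1 := by
      have := hρ 1
      rw [one_mul] at this
      rwa [← this]
    have h4 : ((ε : ℂ) • (Fintype.card κ : ℂ)).re = ε * Fintype.card κ := by
      simp
    rw [h4] at h2
    have h5 : 0 ≤ ρ.trace.re := (Complex.nonneg_iff.1 hρ0.trace_nonneg).1
    calc rnorm B ≤ (G B).re := hGB
      _ ≤ ‖G B‖ := Complex.re_le_norm _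
      _ ≤ _ := h2
      _ ≤ D.toReal * (ρ.trace.re + ε * Fintype.card κ) :=
        mul_le_mul_of_nonneg_right h1 (add_nonneg h5 (by positivity))
      _ ≤ _ := mul_le_mul_of_nonneg_left (by linarith) ENNReal.toReal_nonneg
  rw [← ofReal_rnorm]
  refine ENNReal.ofReal_le_of_le_toReal (le_of_forall_pos_le_add fun δ hδ => ?_)
  have hM : 0 ≤ D.toReal * Fintype.card κ := by positivity
  -- The `+ 1` keeps the denominator positive when `D` or `|κ|` vanishes.
  have h1 := key (δ / (D.toReal * Fintype.card κ + 1)) (by positivity)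
  refine h1.trans ?_
  have h2 : δ / (D.toReal * Fintype.card κ + 1) * (D.toReal * Fintype.card κ) ≤ δ := by
    rw [div_mul_eq_mul_div, div_le_iff₀ (by positivity)]
    nlinarith
  linarith

/-- The completely bounded norm of a completely positive map is determined by its values on
positive matrices. -/
theorem cbNorm_le_of_isCP {T : X →ₗ[ℂ] Matrix κ κ Y} (hT : IsCP T) {c : ℝ≥0∞}
    (h : ∀ (ι : Type) [Fintype ι] (a : Matrix ι ι X), a ∈ cone ι → mnorm a ≤ 1 →
      mnorm (a.map T) ≤ c) : cbNorm T ≤ c := by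
  refine cbNorm_le_of_forall_lt_one fun ι _ A hA => ?_
  obtain ⟨a, b, ha1, hb1, hab⟩ := exists_fromBlocks_mem_cone hA
  have h0 : Matrix.comp _ _ κ κ Y ((Matrix.fromBlocks a A Aᴴ b).map T) ∈ cone _ := hT _ _ hab
  have h1 := submatrix_mem_cone h0 (Equiv.sumProdDistrib ι ι κ).symm
  rw [comp_fromBlocks_map] at h1
  refine (mnorm_le_of_fromBlocks_mem_cone h1).trans (max_le ?_ ?_)
  · exact h ι a (submatrix_mem_cone hab Sum.inl) ha1.le
  · exact h ι b (submatrix_mem_cone hab Sum.inr) hb1.le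

end CompletelyPositive

/-! ## Bounded functionals and rank one maps -/

section BoundedFunctionals

variable {X : Type u} [AddCommGroup X] [Module ℂ X] [StarAddMonoid X] [StarModule ℂ X]
  [MatrixNormCone X] [MatrixRegularOperatorSpace X]
variable {Y : Type v} [AddCommGroup Y] [Module ℂ Y] [StarAddMonoid Y] [StarModule ℂ Y]
  [MatrixNormCone Y] [MatrixRegularOperatorSpace Y]
variable {ι κ : Type} [Fintype ι] [Fintype κ]

open MatrixOrderedOperatorSpace MatrixRegularOperatorSpace

/-- For `κ = Unit` the associated map is `f` itself. Hence positive functionals are automatically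
c.p., and bounded ones are completely bounded with the same constant. -/
theorem functionalMap_entry (f : X →ₗ[ℂ] ℂ) (A : Matrix ι ι X) :
    (Matrix.comp ι ι Unit Unit ℂ
        (A.map (functionalMap (f ∘ₗ Matrix.entryLinearMap ℂ X () ())))).submatrix
        (Equiv.prodPUnit ι).symm (Equiv.prodPUnit ι).symm = A.map f := by
  ext i j
  simp [functionalMap]

theorem isCP_of_forall_nonneg {f : X →ₗ[ℂ] ℂ}
    (h : ∀ x : Matrix Unit Unit X, x ∈ cone Unit → 0 ≤ f (x () ())) : IsCP f := by
  intro ι _ A hA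
  have h1 : IsCP (functionalMap (f ∘ₗ Matrix.entryLinearMap ℂ X () ())) :=
    isCP_functionalMap fun ι _ A hA α => h _ (conj_mem_cone α hA)
  have h2 : (Matrix.comp ι ι Unit Unit ℂ
    (A.map (functionalMap (f ∘ₗ Matrix.entryLinearMap ℂ X () ())))).PosSemidef := h1 ι A hA
  have h3 := h2.submatrix (Equiv.prodPUnit ι).symm
  rwa [functionalMap_entry] at h3

theorem cbNorm_le_of_forall_enorm_le {f : X →ₗ[ℂ] ℂ} {C : ℝ≥0}
    (h : ∀ x, ‖f x‖ₑ ≤ C * elemNorm x) : cbNorm f ≤ C := by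
  refine cbNorm_le_of_forall fun ι _ A => ?_
  have h1 : cbNorm (functionalMap (f ∘ₗ Matrix.entryLinearMap ℂ X () ())) ≤ C :=
    cbNorm_functionalMap_le fun x => h (x () ())
  have h2 := (mnorm_map_le (functionalMap (f ∘ₗ Matrix.entryLinearMap ℂ X () ())) A).trans
    (mul_le_mul_left h1 _)
  rw [← functionalMap_entry]
  refine le_trans (le_of_eq ?_) h2
  exact mnorm_submatrix_equiv (X := ℂ) _ (Equiv.prodPUnit ι).symm (Equiv.prodPUnit ι).symm

theorem IsBoundedMap.exists_enorm_le {f : X →ₗ[ℂ] ℂ} (hf : IsBoundedMap f) :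
    ∃ C : ℝ≥0, ∀ x, ‖f x‖ₑ ≤ C * elemNorm x := by
  obtain ⟨C, hC⟩ := hf
  exact ⟨C, fun x => by simpa only [elemNorm_complex] using hC x⟩

/-- A bounded hermitian functional is dominated by a bounded positive functional. -/
theorem exists_dominating_functional {f : X →ₗ[ℂ] ℂ} {C : ℝ≥0}
    (hC : ∀ x, ‖f x‖ₑ ≤ C * elemNorm x) (hf : ∀ x, f (star x) = star (f x)) :
    ∃ g : X →ₗ[ℂ] ℂ, (∀ x, ‖g x‖ₑ ≤ C * elemNorm x) ∧
      ∀ x : Matrix Unit Unit X, x ∈ cone Unit → 0 ≤ g (x () ()) ∧ f (x () ()) ≤ g (x () ()) := by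
  have hfr : ∀ x : Matrix Unit Unit X, (f (x () ())).re ≤ C * rnorm x := by
    intro x
    have h1 := ENNReal.toReal_mono
      (ENNReal.mul_ne_top ENNReal.coe_ne_top (OperatorSpace.mnorm_ne_top x)) (hC (x () ()))
    rw [toReal_enorm, ENNReal.toReal_mul, ENNReal.coe_toReal] at h1
    exact (Complex.re_le_norm _).trans h1
  -- The cone encodes `g ≤ C ‖·‖` and `± f ≤ g` on positive elements. It is consistent because `-(a
  -- + b) ≤ a - b ≤ a + b` gives `f(a - b) ≤ C ‖a - b‖ ≤ C ‖a + b‖`.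
  obtain ⟨g, hg⟩ := exists_linearMap_le_of_cone (E := Matrix Unit Unit X)
    (fun x t => ∃ a ∈ cone (V := X) Unit, ∃ b ∈ cone (V := X) Unit,
      C * rnorm (symPart x + (a + b)) - (f ((a - b) () ())).re ≤ t)
    ⟨0, zero_mem_cone _, 0, zero_mem_cone _, by simp [rnorm_zero]⟩
    (by
      rintro x y t t' ⟨a, ha, b, hb, h⟩ ⟨a', ha', b', hb', h'⟩
      refine ⟨a + a', add_mem_cone ha ha', b + b', add_mem_cone hb hb', ?_⟩
      have e1 : symPart (x + y) + (a + a' + (b + b'))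
          = (symPart x + (a + b)) + (symPart y + (a' + b')) := by
        rw [map_add]; abel
      have e2 : (a + a' - (b + b')) () () = (a - b) () () + (a' - b') () () := by
        simp only [Matrix.add_apply, Matrix.sub_apply]; abel
      rw [e1, e2, map_add, Complex.add_re]
      have := mul_le_mul_of_nonneg_left (rnorm_add_le (symPart x + (a + b)) (symPart y + (a' + b')))
        C.coe_nonneg
      linarith)
    (by
      rintro x t r hr ⟨a, ha, b, hb, h⟩
      refine ⟨r • a, real_smul_mem_cone hr.le ha, r • b, real_smul_mem_cone hr.le hb, ?_⟩
      rw [map_smul, ← smul_add, ← smul_add, ← smul_sub, rnorm_real_smul hr.le, Matrix.smul_apply,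
        ← Complex.coe_smul, map_smul, smul_eq_mul, Complex.re_ofReal_mul]
      have := mul_le_mul_of_nonneg_left h hr.le
      linarith)
    (fun x => ⟨_, 0, zero_mem_cone _, 0, zero_mem_cone _, le_rfl⟩)
    (by
      rintro t ⟨a, ha, b, hb, h⟩
      have h1 : mnorm (a - b) ≤ mnorm (a + b) := by
        refine mnorm_le_of_le _ _ ?_ (add_mem_cone ha hb) ?_ ?_
        · rw [Matrix.conjTranspose_sub, isSelfAdjoint_of_mem ha, isSelfAdjoint_of_mem hb]
        · rw [(by abel : a - b + (a + b) = a + a)]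
          exact add_mem_cone ha ha
        · rw [(by abel : a + b - (a - b) = b + b)]
          exact add_mem_cone hb hb
      have h2 := mul_le_mul_of_nonneg_left (rnorm_mono h1) C.coe_nonneg
      have h3 := hfr (a - b)
      rw [map_zero, zero_add] at h
      linarith)
  have hskew : ∀ x, xᴴ = -x → g x ≤ 0 := fun x hx =>
    hg x 0 ⟨0, zero_mem_cone _, 0, zero_mem_cone _, by
      rw [symPart_of_skew hx]; simp [rnorm_zero]⟩
  have hpos : ∀ x ∈ cone (V := X) Unit, (f (x () ())).re ≤ g x := by
    intro x hx
    have h := hg (-x) (-(f (x () ())).re) ⟨x, hx, 0, zero_mem_cone _, by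
      rw [map_neg, symPart_of_isSelfAdjoint (isSelfAdjoint_of_mem hx)]; simp [rnorm_zero]⟩
    rw [map_neg] at h
    exact neg_le_neg_iff.1 h
  have hneg : ∀ x ∈ cone (V := X) Unit, -(f (x () ())).re ≤ g x := by
    intro x hx
    have h := hg (-x) ((f (x () ())).re) ⟨0, zero_mem_cone _, x, hx, by
      rw [map_neg, symPart_of_isSelfAdjoint (isSelfAdjoint_of_mem hx)]; simp [rnorm_zero]⟩
    rw [map_neg] at h
    linarith
  obtain ⟨G, hG, hGsa⟩ := exists_complex_of_real g fun x hx => by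
    refine le_antisymm (hskew x hx) ?_
    have h := hskew (-x) (by rw [Matrix.conjTranspose_neg, hx])
    rw [map_neg] at h
    linarith
  let g' : X →ₗ[ℂ] ℂ :=
    { toFun := fun x => G (Matrix.of fun _ _ => x)
      map_add' := fun x y => by rw [← map_add]; rfl
      map_smul' := fun c x => by rw [RingHom.id_apply, ← map_smul]; rfl }
  refine ⟨g', fun x => enorm_le_of_re_le (G := G) (fun x => ?_) _, fun x hx => ?_⟩
  · rw [hG]
    refine hg x _ ⟨0, zero_mem_cone _, 0, zero_mem_cone _, ?_⟩
    simpa using mul_le_mul_of_nonneg_left (rnorm_symPart_le x) C.coe_nonneg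
  · have hx' := isSelfAdjoint_of_mem hx
    have e : g' (x () ()) = (g x : ℂ) := hGsa x hx'
    have him : (f (x () ())).im = 0 := by
      rw [← Complex.conj_eq_iff_im, ← Complex.star_def, ← hf]
      exact congrArg f (congrFun (congrFun hx' ()) ())
    rw [e, Complex.le_def]
    have h1 := hpos x hx
    have h2 := hneg x hx
    exact ⟨Complex.zero_le_real.2 (by linarith), h1, by rw [him, Complex.ofReal_im]⟩

/-- Bounded functionals are linear combinations of positive ones. -/
theorem mem_span_isCP_of_isBoundedMap {f : X →ₗ[ℂ] ℂ} (hf : IsBoundedMap f) :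
    f ∈ Submodule.span ℂ {g : X →ₗ[ℂ] ℂ | IsCP g ∧ cbNorm g ≠ ∞} := by
  have key : ∀ f : X →ₗ[ℂ] ℂ, IsBoundedMap f → (∀ x, f (star x) = star (f x)) →
      f ∈ Submodule.span ℂ {g : X →ₗ[ℂ] ℂ | IsCP g ∧ cbNorm g ≠ ∞} := by
    intro f hf hs
    obtain ⟨C, hC⟩ := hf.exists_enorm_le
    obtain ⟨g, hg, hgpos⟩ := exists_dominating_functional hC hs
    have e : f = g - (g - f) := by abel
    rw [e]
    refine Submodule.sub_mem _ (Submodule.subset_span ⟨isCP_of_forall_nonneg fun x hx =>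
      (hgpos x hx).1, ?_⟩) (Submodule.subset_span ⟨isCP_of_forall_nonneg fun x hx => ?_, ?_⟩)
    · exact ((cbNorm_le_of_forall_enorm_le hg).trans_lt ENNReal.coe_lt_top).ne
    · rw [LinearMap.sub_apply, sub_nonneg]
      exact (hgpos x hx).2
    · refine ((cbNorm_le_of_forall_enorm_le (C := C + C) fun x => ?_).trans_lt
        ENNReal.coe_lt_top).ne
      rw [LinearMap.sub_apply, ENNReal.coe_add, add_mul]
      exact enorm_sub_le.trans (add_le_add (hg x) (hC x))
  set F : boundedDual X := ⟨f, hf⟩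
  -- This splits `f` into two hermitian functionals, to each of which `key` applies.
  have e : f = (2⁻¹ : ℂ) • ((F + star F : boundedDual X) : X →ₗ[ℂ] ℂ)
      + (-(2⁻¹ : ℂ) * Complex.I) • ((Complex.I • (F - star F) : boundedDual X) : X →ₗ[ℂ] ℂ) := by
    have e1 : f = ((2⁻¹ : ℂ) • (F + star F) + (-(2⁻¹ : ℂ) * Complex.I) • (Complex.I • (F - star F))
        : boundedDual X) := by
      rw [smul_smul, mul_assoc, Complex.I_mul_I, (by norm_num : -(2⁻¹ : ℂ) * -1 = 2⁻¹), ← smul_add,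
        (by abel : F + star F + (F - star F) = F + F), ← two_smul ℂ, smul_smul]
      norm_num [F]
    exact e1
  have hstar : ∀ (H : boundedDual X), star H = H → ∀ x, H.1 (star x) = star (H.1 x) := by
    intro H hH x
    conv_lhs => rw [← hH]
    change star (H.1 (star (star x))) = _
    rw [star_star]
  rw [e]
  refine Submodule.add_mem _ (Submodule.smul_mem _ _ (key _ (F + star F).2 (hstar _ ?_)))
    (Submodule.smul_mem _ _ (key _ (Complex.I • (F - star F)).2 (hstar _ ?_)))
  · rw [star_add, star_star, add_comm]
  · rw [star_smul, star_sub, star_star, Complex.star_def, Complex.conj_I]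
    refine (neg_smul Complex.I (star F - F)).trans ?_
    rw [← smul_neg, neg_sub]

/-- A matrix regular operator space is spanned by its positive elements. -/
theorem mem_span_cone (x : X) :
    x ∈ Submodule.span ℂ {a : X | (Matrix.of fun _ _ : Unit => a) ∈ cone Unit} := by
  have key : ∀ y : X, star y = y →
      y ∈ Submodule.span ℂ {a : X | (Matrix.of fun _ _ : Unit => a) ∈ cone Unit} := by
    intro y hy
    obtain ⟨a, ha, b, hb, h⟩ := exists_mem_cone_sub_eq (x := Matrix.of fun _ _ : Unit => y)
      (by ext; simp [hy])
    have e : y = a () () - b () () := congrFun (congrFun h ()) ()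
    rw [e]
    exact Submodule.sub_mem _ (Submodule.subset_span ha) (Submodule.subset_span hb)
  have e : x = (2⁻¹ : ℂ) • (x + star x) + (-(2⁻¹ : ℂ) * Complex.I) • (Complex.I • (x - star x)) := by
    rw [smul_smul, mul_assoc, Complex.I_mul_I, (by norm_num : -(2⁻¹ : ℂ) * -1 = 2⁻¹), ← smul_add,
      (by abel : x + star x + (x - star x) = x + x), ← two_smul ℂ, smul_smul]
    norm_num
  rw [e]
  refine Submodule.add_mem _ (Submodule.smul_mem _ _ (key _ ?_))
    (Submodule.smul_mem _ _ (key _ ?_))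
  · rw [star_add, star_star, add_comm]
  · rw [star_smul, star_sub, star_star, Complex.star_def, Complex.conj_I, neg_smul, ← smul_neg,
      neg_sub]

/-- Induction on the index type, adding one copy of `w` at a time by the direct sum axiom. -/
theorem mnorm_diagonal_le [DecidableEq ι] (w : Y) :
    mnorm (Matrix.diagonal fun _ : ι => w) ≤ elemNorm w := by
  let P : ∀ (α : Type) [Fintype α], Prop := fun α _ => ∀ [DecidableEq α],
    mnorm (Matrix.diagonal fun _ : α => w) ≤ elemNorm w
  have h : P ι := by
    refine Fintype.induction_empty_option (P := fun α _ => P α) ?_ ?_ ?_ ι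
    · intro α β _ e h _
      classical
      have e1 : (Matrix.diagonal fun _ : α => w).submatrix e.symm e.symm
          = Matrix.diagonal fun _ : β => w := by
        ext i j; simp [Matrix.diagonal_apply]
      have _ := Fintype.ofEquiv β e.symm
      rw [← e1, mnorm_submatrix_equiv]
      convert h
    · intro _
      rw [(Matrix.ext fun i => i.elim : (Matrix.diagonal fun _ : PEmpty => w) = 0), mnorm_zero]
      exact zero_le
    · intro α _ h _
      classical
      have e1 : (Matrix.diagonal fun _ : Option α => w).submatrix
          (Equiv.optionEquivSumPUnit α).symm (Equiv.optionEquivSumPUnit α).symm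
          = Matrix.fromBlocks (Matrix.diagonal fun _ : α => w) 0 0
            (Matrix.of fun _ _ : Unit => w) := by
        ext i j
        rcases i with i | ⟨⟩ <;> rcases j with j | ⟨⟩ <;> simp [Matrix.diagonal_apply]
      rw [← mnorm_submatrix_equiv _ (Equiv.optionEquivSumPUnit α).symm
        (Equiv.optionEquivSumPUnit α).symm, e1, OperatorSpace.mnorm_diag]
      exact max_le h le_rfl
  exact h

theorem cbNorm_smulRight_le (f : X →ₗ[ℂ] ℂ) (w : Y) :
    cbNorm (f.smulRight w) ≤ cbNorm f * elemNorm w := by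
  classical
  refine cbNorm_le_of_forall fun ι _ A => ?_
  have e : A.map (f.smulRight w)
      = scalarMul (A.map f) (Matrix.diagonal fun _ : ι => w) (1 : Matrix ι ι ℂ) := by
    ext i j
    simp [scalarMul, Matrix.diagonal_apply, Matrix.one_apply]
  rw [e]
  refine (mnorm_scalarMul_le_of_le _ _ _ le_rfl opNorm_one_le).trans ?_
  rw [ENNReal.ofReal_one, mul_one]
  calc _ ≤ (cbNorm f * mnorm A) * elemNorm w :=
        mul_le_mul' (mnorm_map_le f A) (mnorm_diagonal_le w)
    _ = _ := by ring

theorem isCP_smulRight {f : X →ₗ[ℂ] ℂ} (hf : IsCP f) {w : Y}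
    (hw : (Matrix.of fun _ _ : Unit => w) ∈ cone Unit) : IsCP (f.smulRight w) := by
  classical
  intro ι _ A hA
  have h1 : (A.map f).PosSemidef := hf ι A hA
  obtain ⟨s, hs⟩ : ∃ s : Matrix ι ι ℂ, A.map f = sᴴ * s := by
    open scoped MatrixOrder in
    exact CStarAlgebra.nonneg_iff_eq_star_mul_self.1 h1.nonneg
  -- Factoring `f(A) = s^* s` writes `f(A) ⊗ w` as a sum of conjugates of `w` by the rows of `s`.
  have e : A.map (f.smulRight w) = ∑ k, scalarMul (Matrix.of fun (_ : Unit) i => s k i)ᴴ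
      (Matrix.of fun _ _ : Unit => w) (Matrix.of fun (_ : Unit) i => s k i) := by
    ext i j
    have h2 : f (A i j) = ∑ k, star (s k i) * s k j := congrFun (congrFun hs i) j
    simp [scalarMul, Matrix.sum_apply, h2, Finset.sum_smul]
  rw [e]
  exact Finset.sum_induction _ (· ∈ cone ι) (fun _ _ => add_mem_cone) (zero_mem_cone ι)
    fun k _ => conj_mem_cone _ hw

/-- By bilinearity it is enough to treat a positive functional and a positive element, where the
rank one map is c.p. and completely bounded. -/
theorem smulRight_mem_decMaps {f : X →ₗ[ℂ] ℂ} (hf : IsBoundedMap f) (w : Y) :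
    f.smulRight w ∈ decMaps X Y := by
  have hw := mem_span_cone w
  induction hw using Submodule.span_induction with
  | zero => rw [(by ext; simp : f.smulRight (0 : Y) = 0)]; exact Submodule.zero_mem _
  | add x y _ _ hx hy =>
    rw [(by ext; simp : f.smulRight (x + y) = f.smulRight x + f.smulRight y)]
    exact Submodule.add_mem _ hx hy
  | smul c x _ hx =>
    rw [(by ext; simp [smul_comm c] : f.smulRight (c • x) = c • f.smulRight x)]
    exact Submodule.smul_mem _ _ hx
  | mem w hw =>
    have hf' := mem_span_isCP_of_isBoundedMap hf
    clear hf
    induction hf' using Submodule.span_induction with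
    | zero => rw [(by ext; simp : (0 : X →ₗ[ℂ] ℂ).smulRight w = 0)]; exact Submodule.zero_mem _
    | add x y _ _ hx hy =>
      rw [(by ext; simp [add_smul] : (x + y).smulRight w = x.smulRight w + y.smulRight w)]
      exact Submodule.add_mem _ hx hy
    | smul c x _ hx =>
      rw [(by ext; simp [mul_smul] : (c • x).smulRight w = c • x.smulRight w)]
      exact Submodule.smul_mem _ _ hx
    | mem g hg =>
      refine Submodule.subset_span ⟨isCP_smulRight hg.1 hw, ?_⟩
      exact (cbNorm_smulRight_le g w).trans_lt
        (ENNReal.mul_lt_top (lt_top_iff_ne_top.2 hg.2)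
          (lt_top_iff_ne_top.2 (OperatorSpace.mnorm_ne_top _)))

end BoundedFunctionals

/-! ## The map from the tensor product to linear maps -/

section TensorMaps

variable {V : Type u} [AddCommGroup V] [Module ℂ V] [StarAddMonoid V] [StarModule ℂ V]
  [MatrixNormCone V] [MatrixRegularOperatorSpace V]
variable {W : Type v} [AddCommGroup W] [Module ℂ W] [StarAddMonoid W] [StarModule ℂ W]
  [MatrixNormCone W] [MatrixRegularOperatorSpace W]
variable {ι κ μ : Type} [Fintype ι] [Fintype κ] [Fintype μ]

open MatrixOrderedOperatorSpace MatrixRegularOperatorSpace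

variable (V W) in
/-- The map `V^* ⊗ W → Hom(V, W)` which sends `f ⊗ w` to `v ↦ f(v) w`. -/
def tensorToMap : boundedDual V ⊗[ℂ] W →ₗ[ℂ] V →ₗ[ℂ] W :=
  TensorProduct.lift (LinearMap.mk₂ ℂ (fun f w => (f : V →ₗ[ℂ] ℂ).smulRight w)
    (fun f g w => by ext; simp [add_smul])
    (fun c f w => by ext; simp [mul_smul])
    (fun f w w' => by ext; simp)
    (fun c f w => by ext; simp [smul_comm c]))

theorem tensorToMap_tmul (f : boundedDual V) (w : W) :
    tensorToMap V W (f ⊗ₜ[ℂ] w) = (f : V →ₗ[ℂ] ℂ).smulRight w := rfl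

theorem tensorToMap_mem_decMaps (t : boundedDual V ⊗[ℂ] W) :
    tensorToMap V W t ∈ decMaps V W := by
  induction t with
  | zero => rw [map_zero]; exact Submodule.zero_mem _
  | tmul f w => exact smulRight_mem_decMaps f.2 w
  | add x y hx hy => rw [map_add]; exact Submodule.add_mem _ hx hy

theorem tensorToMap_star (t : boundedDual V ⊗[ℂ] W) (v : V) :
    tensorToMap V W (star t) v = star (tensorToMap V W t (star v)) := by
  induction t with
  | zero => simp
  | tmul f w =>
    rw [TensorProduct.star_tmul, tensorToMap_tmul, tensorToMap_tmul, LinearMap.smulRight_apply,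
      LinearMap.smulRight_apply, star_smul]
    rfl
  | add x y hx hy =>
    rw [star_add, map_add, map_add, LinearMap.add_apply, LinearMap.add_apply, star_add, hx, hy]

/-- The slice map `V^* ⊗ W → V^*` of a functional on `W`. -/
def sliceRight (θ : W →ₗ[ℂ] ℂ) : boundedDual V ⊗[ℂ] W →ₗ[ℂ] boundedDual V :=
  (TensorProduct.rid ℂ (boundedDual V)).toLinearMap ∘ₗ LinearMap.lTensor (boundedDual V) θ

theorem sliceRight_tmul (θ : W →ₗ[ℂ] ℂ) (f : boundedDual V) (w : W) :
    sliceRight θ (f ⊗ₜ[ℂ] w) = θ w • f := by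
  simp [sliceRight]

theorem sliceRight_apply (θ : W →ₗ[ℂ] ℂ) (t : boundedDual V ⊗[ℂ] W) (v : V) :
    (sliceRight θ t : V →ₗ[ℂ] ℂ) v = θ (tensorToMap V W t v) := by
  induction t with
  | zero => simp
  | tmul f w =>
    rw [sliceRight_tmul, tensorToMap_tmul, LinearMap.smulRight_apply, map_smul]
    exact mul_comm _ _
  | add x y hx hy =>
    rw [map_add, map_add, LinearMap.add_apply, map_add, ← hx, ← hy]
    rfl

/-- Slicing with the coordinate functionals of an algebraic basis of `W` recovers the coefficients
in `V^*`. No continuity of the coordinates is needed. -/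
theorem tensorToMap_injective : Function.Injective (tensorToMap V W) := by
  classical
  rw [injective_iff_map_eq_zero]
  intro t ht
  let b := Module.Basis.ofVectorSpace ℂ W
  refine (TensorProduct.equivFinsuppOfBasisRight (M := boundedDual V) b).injective ?_
  rw [map_zero]
  ext i v
  rw [TensorProduct.equivFinsuppOfBasisRight_apply]
  refine (sliceRight_apply (b.coord i) t v).trans ?_
  rw [ht]
  simp

/-- This is the factorization `φ ⊗ ψ = (φ ⊗ id) ∘ (id ⊗ ψ)` in entries, which allows the two maps to
be handled one after the other. -/
theorem tensorMap_apply (φ : boundedDual V →ₗ[ℂ] Matrix κ κ ℂ) (ψ : W →ₗ[ℂ] Matrix μ μ ℂ)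
    (t : boundedDual V ⊗[ℂ] W) (k k' : κ) (m m' : μ) :
    tensorMap φ ψ t (k, m) (k', m')
      = φ (sliceRight (Matrix.entryLinearMap ℂ ℂ m m' ∘ₗ ψ) t) k k' := by
  induction t with
  | zero => simp
  | tmul f w =>
    rw [sliceRight_tmul, map_smul]
    simp [tensorMap, mul_comm]
  | add x y hx hy =>
    rw [map_add, map_add, map_add, Matrix.add_apply, Matrix.add_apply, hx, hy]

/-- The matrix `(id ⊗ ψ)(z)` over `V^*`. -/
def sliceMatrix (ψ : W →ₗ[ℂ] Matrix μ μ ℂ) (z : Matrix ι ι (boundedDual V ⊗[ℂ] W)) :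
    Matrix (ι × μ) (ι × μ) (boundedDual V) :=
  Matrix.of fun p q => sliceRight (Matrix.entryLinearMap ℂ ℂ p.2 q.2 ∘ₗ ψ) (z p.1 q.1)

/-- The linear map `V → M_ι(W)` which corresponds to a matrix over `V^* ⊗ W`. -/
def matrixToMap (z : Matrix ι ι (boundedDual V ⊗[ℂ] W)) : V →ₗ[ℂ] Matrix ι ι W :=
  matrixMap (z.map (tensorToMap V W))

theorem matrixToMap_apply (z : Matrix ι ι (boundedDual V ⊗[ℂ] W)) (v : V) (i j : ι) :
    matrixToMap z v i j = tensorToMap V W (z i j) v := rfl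

theorem comp_map_tensorMap (φ : boundedDual V →ₗ[ℂ] Matrix κ κ ℂ) (ψ : W →ₗ[ℂ] Matrix μ μ ℂ)
    (z : Matrix ι ι (boundedDual V ⊗[ℂ] W)) :
    Matrix.comp ι ι (κ × μ) (κ × μ) ℂ (z.map (tensorMap φ ψ))
      = (Matrix.comp (ι × μ) (ι × μ) κ κ ℂ ((sliceMatrix ψ z).map φ)).submatrix
          (((Equiv.refl ι).prodCongr (Equiv.prodComm κ μ)).trans (Equiv.prodAssoc ι μ κ).symm)
          (((Equiv.refl ι).prodCongr (Equiv.prodComm κ μ)).trans (Equiv.prodAssoc ι μ κ).symm) := by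
  ext ⟨i, k, m⟩ ⟨j, k', m'⟩
  exact tensorMap_apply φ ψ (z i j) k k' m m'

/-- As a map on `V`, the matrix `(id ⊗ ψ)(z)` is `T_z` followed by the amplification of `ψ`, up to
reindexing. -/
theorem comp_map_sliceMatrix (ψ : W →ₗ[ℂ] Matrix μ μ ℂ) (z : Matrix ι ι (boundedDual V ⊗[ℂ] W))
    (a : Matrix κ κ V) :
    Matrix.comp κ κ (ι × μ) (ι × μ) ℂ
        (a.map (matrixMap ((sliceMatrix ψ z).map fun f => (f : V →ₗ[ℂ] ℂ))))
      = (Matrix.comp (κ × ι) (κ × ι) μ μ ℂ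
          ((Matrix.comp κ κ ι ι W (a.map (matrixToMap z))).map ψ)).submatrix
          (Equiv.prodAssoc κ ι μ).symm (Equiv.prodAssoc κ ι μ).symm := by
  ext ⟨k, i, m⟩ ⟨k', j, m'⟩
  exact sliceRight_apply _ (z i j) (a k k')

/-- Evaluation of functionals at a matrix over `V`. -/
def evalMap (a : Matrix κ κ V) : boundedDual V →ₗ[ℂ] Matrix κ κ ℂ where
  toFun f := a.map (f : V →ₗ[ℂ] ℂ)
  map_add' f g := by ext; simp
  map_smul' c f := by ext; simp

/-- Evaluating `F` at `a` and applying the map of `F` to `a` differ only by the tensor flip. So the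
definition of the norms and cones of `V^*` makes evaluation c.p. or contractive according to `a`. -/
theorem comp_map_evalMap (a : Matrix κ κ V) (F : Matrix ι ι (boundedDual V)) :
    Matrix.comp ι ι κ κ ℂ (F.map (evalMap a))
      = (Matrix.comp κ κ ι ι ℂ (a.map (matrixMap (F.map fun f => (f : V →ₗ[ℂ] ℂ))))).submatrix
          (Equiv.prodComm ι κ) (Equiv.prodComm ι κ) := by
  ext ⟨i, k⟩ ⟨j, l⟩
  rfl

theorem comp_map_tensorMap_evalMap (a : Matrix κ κ V) (ψ : W →ₗ[ℂ] Matrix μ μ ℂ)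
    (z : Matrix ι ι (boundedDual V ⊗[ℂ] W)) :
    Matrix.comp ι ι (κ × μ) (κ × μ) ℂ (z.map (tensorMap (evalMap a) ψ))
      = (Matrix.comp (κ × ι) (κ × ι) μ μ ℂ
          ((Matrix.comp κ κ ι ι W (a.map (matrixToMap z))).map ψ)).submatrix
          ((Equiv.prodAssoc ι κ μ).symm.trans ((Equiv.prodComm ι κ).prodCongr (Equiv.refl μ)))
          ((Equiv.prodAssoc ι κ μ).symm.trans ((Equiv.prodComm ι κ).prodCongr (Equiv.refl μ))) := by
  ext ⟨i, k, m⟩ ⟨j, k', m'⟩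
  exact (tensorMap_apply (evalMap a) ψ (z i j) k k' m m').trans
    (sliceRight_apply _ (z i j) (a k k'))

theorem isCP_evalMap {a : Matrix κ κ V} (ha : a ∈ cone κ) : IsCP (evalMap a) := by
  intro ι _ F hF
  change (Matrix.comp ι ι κ κ ℂ (F.map (evalMap a))).PosSemidef
  rw [comp_map_evalMap]
  have h : (Matrix.comp κ κ ι ι ℂ
    (a.map (matrixMap (F.map fun f => (f : V →ₗ[ℂ] ℂ))))).PosSemidef := hF κ a ha
  exact h.submatrix _

theorem mnorm_map_evalMap_le (a : Matrix κ κ V) (F : Matrix ι ι (boundedDual V)) :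
    mnorm (F.map (evalMap a)) ≤ mnorm F * mnorm a := by
  change mnorm (Matrix.comp ι ι κ κ ℂ (F.map (evalMap a))) ≤ _
  rw [comp_map_evalMap, mnorm_submatrix_equiv (X := ℂ)]
  exact mnorm_map_le (matrixMap (F.map fun f => (f : V →ₗ[ℂ] ℂ))) a

theorem isBoundedMap_evalMap (a : Matrix κ κ V) : IsBoundedMap (evalMap a) := by
  refine ⟨(mnorm a).toNNReal, fun f => ?_⟩
  rw [ENNReal.coe_toNNReal (OperatorSpace.mnorm_ne_top a), mul_comm]
  exact mnorm_map_evalMap_le a (Matrix.of fun _ _ : Unit => f)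

theorem isCompleteContraction_evalMap {a : Matrix κ κ V} (ha : mnorm a ≤ 1) :
    IsCompleteContraction (evalMap a) := fun _ _ F =>
  (mnorm_map_evalMap_le a F).trans (mul_le_of_le_one_right' ha)

/-- The cone of `V^* ⊗ W` consists of the matrices which correspond to completely positive maps. -/
theorem mem_deltaCone_iff (z : Matrix ι ι (boundedDual V ⊗[ℂ] W)) :
    z ∈ deltaCone (V := boundedDual V) (W := W) ι ↔ IsCP (matrixToMap z) := by
  constructor
  · intro hz κ _ a ha
    change Matrix.comp κ κ ι ι W (a.map (matrixToMap z)) ∈ cone (κ × ι)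
    refine mem_cone_of_forall_isCP fun μ _ ψ hψ hψb => ?_
    have h : (Matrix.comp ι ι (κ × μ) (κ × μ) ℂ (z.map (tensorMap (evalMap a) ψ))).PosSemidef :=
      hz κ μ (evalMap a) ψ (isCP_evalMap ha) (isBoundedMap_evalMap a) hψ (isBoundedMap_of_cbNorm hψb)
    rw [comp_map_tensorMap_evalMap, Matrix.posSemidef_submatrix_equiv] at h
    exact h
  · intro hz κ μ _ _ φ ψ hφ _ hψ _
    have h : sliceMatrix ψ z ∈ cone (ι × μ) := by
      intro κ _ a ha
      change (Matrix.comp κ κ (ι × μ) (ι × μ) ℂ _).PosSemidef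
      rw [comp_map_sliceMatrix, Matrix.posSemidef_submatrix_equiv]
      exact hψ _ _ (hz κ a ha)
    have h2 : (Matrix.comp (ι × μ) (ι × μ) κ κ ℂ ((sliceMatrix ψ z).map φ)).PosSemidef := hφ _ _ h
    change (Matrix.comp ι ι (κ × μ) (κ × μ) ℂ _).PosSemidef
    rw [comp_map_tensorMap]
    exact h2.submatrix _

theorem mnorm_map_tensorMap_evalMap (a : Matrix κ κ V) (ψ : W →ₗ[ℂ] Matrix μ μ ℂ)
    (z : Matrix ι ι (boundedDual V ⊗[ℂ] W)) :
    mnorm (z.map (tensorMap (evalMap a) ψ))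
      = mnorm ((Matrix.comp κ κ ι ι W (a.map (matrixToMap z))).map ψ) := by
  change mnorm (Matrix.comp ι ι (κ × μ) (κ × μ) ℂ (z.map (tensorMap (evalMap a) ψ)))
    = mnorm (Matrix.comp (κ × ι) (κ × ι) μ μ ℂ _)
  rw [comp_map_tensorMap_evalMap, mnorm_submatrix_equiv (X := ℂ)]

theorem le_deltaAbs (z : Matrix ι ι (boundedDual V ⊗[ℂ] W))
    {φ : boundedDual V →ₗ[ℂ] Matrix κ κ ℂ} {ψ : W →ₗ[ℂ] Matrix μ μ ℂ}
    (hφ : IsCP φ ∧ IsCompleteContraction φ) (hψ : IsCP ψ ∧ IsCompleteContraction ψ) :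
    mnorm (z.map (tensorMap φ ψ)) ≤ deltaAbs z := by
  unfold deltaAbs
  refine le_iSup_of_le κ (le_iSup_of_le μ (le_iSup_of_le inferInstance (le_iSup_of_le inferInstance
    (le_iSup_of_le φ (le_iSup_of_le ψ (le_iSup_of_le hφ (le_iSup_of_le hψ le_rfl)))))))

/-- For a c.p. map only positive contractions `a` matter, and the norm of the positive matrix
`T_u(a)` is seen by c.c.p. maps `ψ`. The pairs (evaluation at `a`, `ψ`) are among those defining
`|u|_δ`. -/
theorem cbNorm_matrixToMap_le_deltaAbs {u : Matrix ι ι (boundedDual V ⊗[ℂ] W)}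
    (hu : IsCP (matrixToMap u)) : cbNorm (matrixToMap u) ≤ deltaAbs u := by
  refine cbNorm_le_of_isCP hu fun κ _ a ha ha1 => ?_
  change mnorm (Matrix.comp κ κ ι ι W (a.map (matrixToMap u))) ≤ _
  refine mnorm_le_of_forall_isCP (X := W) (hu κ a ha) fun ψ hψ hψc => ?_
  rw [← mnorm_map_tensorMap_evalMap]
  exact le_deltaAbs u ⟨isCP_evalMap ha, isCompleteContraction_evalMap ha1⟩ ⟨hψ, hψc⟩

/-- Complete contractivity of `φ` and `ψ` suffices here; positivity plays no role. -/
theorem deltaAbs_le_cbNorm_matrixToMap (u : Matrix ι ι (boundedDual V ⊗[ℂ] W)) :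
    deltaAbs u ≤ cbNorm (matrixToMap u) := by
  refine iSup₂_le fun κ μ => iSup₂_le fun _ _ => iSup₂_le fun φ ψ => iSup₂_le fun hφ hψ => ?_
  change mnorm (Matrix.comp ι ι (κ × μ) (κ × μ) ℂ _) ≤ _
  rw [comp_map_tensorMap, mnorm_submatrix_equiv (X := ℂ)]
  refine (hφ.2 _ (sliceMatrix ψ u)).trans (cbNorm_le_of_forall fun ν _ a => ?_)
  change mnorm (Matrix.comp ν ν (ι × μ) (ι × μ) ℂ _) ≤ _
  rw [comp_map_sliceMatrix, mnorm_submatrix_equiv (X := ℂ)]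
  exact (hψ.2 _ _).trans (mnorm_map_le (matrixToMap u) a)

/-- The map into `M_2(M_ι(W))` in the definition of the decomposable norm, as a block matrix. -/
theorem isCP_block_iff (u z u' : Matrix ι ι (boundedDual V ⊗[ℂ] W)) :
    IsCP (matrixMap !![matrixToMap u, matrixToMap z; adjointMap (matrixToMap z), matrixToMap u'])
      ↔ IsCP (matrixToMap (Matrix.fromBlocks u z zᴴ u')) := by
  have key : ∀ (κ : Type) [Fintype κ] (a : Matrix κ κ V), Matrix.comp κ κ (ι ⊕ ι) (ι ⊕ ι) W
      (a.map (matrixToMap (Matrix.fromBlocks u z zᴴ u')))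
      = (Matrix.comp (κ × Fin 2) (κ × Fin 2) ι ι W (Matrix.comp κ κ (Fin 2) (Fin 2) (Matrix ι ι W)
          (a.map (matrixMap !![matrixToMap u, matrixToMap z;
            adjointMap (matrixToMap z), matrixToMap u'])))).submatrix
          (fun p => Sum.elim (fun i => ((p.1, 0), i)) (fun i => ((p.1, 1), i)) p.2)
          (fun p => Sum.elim (fun i => ((p.1, 0), i)) (fun i => ((p.1, 1), i)) p.2) := by
    intro κ _ a
    ext ⟨k, i⟩ ⟨l, j⟩
    rcases i with i | i <;> rcases j with j | j
    · rfl
    · rfl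
    -- Only this corner uses that the involutions on `V^* ⊗ W` and on maps correspond.
    · exact tensorToMap_star (z j i) (a k l)
    · rfl
  have key2 : ∀ (κ : Type) [Fintype κ] (a : Matrix κ κ V),
      Matrix.comp (κ × Fin 2) (κ × Fin 2) ι ι W (Matrix.comp κ κ (Fin 2) (Fin 2) (Matrix ι ι W)
          (a.map (matrixMap !![matrixToMap u, matrixToMap z;
            adjointMap (matrixToMap z), matrixToMap u'])))
      = (Matrix.comp κ κ (ι ⊕ ι) (ι ⊕ ι) W
          (a.map (matrixToMap (Matrix.fromBlocks u z zᴴ u')))).submatrix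
          (fun p => (p.1.1, if p.1.2 = 0 then Sum.inl p.2 else Sum.inr p.2))
          (fun p => (p.1.1, if p.1.2 = 0 then Sum.inl p.2 else Sum.inr p.2)) := by
    intro κ _ a
    rw [key]
    ext ⟨⟨k, i⟩, x⟩ ⟨⟨l, j⟩, y⟩
    fin_cases i <;> fin_cases j <;> rfl
  constructor
  · intro h κ _ a ha
    change Matrix.comp κ κ (ι ⊕ ι) (ι ⊕ ι) W _ ∈ cone _
    rw [key]
    exact submatrix_mem_cone (X := W) (h κ a ha) _
  · intro h κ _ a ha
    change Matrix.comp (κ × Fin 2) (κ × Fin 2) ι ι W (Matrix.comp κ κ (Fin 2) (Fin 2) _ _) ∈ cone _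
    rw [key2]
    exact submatrix_mem_cone (X := W) (h κ a ha) _

/-- Every pair admissible for `‖z‖_δ` yields a pair admissible for the decomposable norm. The
converse can fail because completely bounded diagonal entries need not come from tensors. -/
theorem decNorm_matrixToMap_le (z : Matrix ι ι (boundedDual V ⊗[ℂ] W)) :
    decNorm (matrixToMap z) ≤ deltaNorm z := by
  refine le_iInf₂ fun u u' => le_iInf fun h => ?_
  have hCP := (mem_deltaCone_iff _).1 h
  have hu : IsCP (matrixToMap u) := fun κ _ a ha =>
    submatrix_mem_cone (X := W) (A := Matrix.comp _ _ _ _ W _) (hCP κ a ha)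
      (fun p : κ × ι => (p.1, (Sum.inl p.2 : ι ⊕ ι)))
  have hu' : IsCP (matrixToMap u') := fun κ _ a ha =>
    submatrix_mem_cone (X := W) (A := Matrix.comp _ _ _ _ W _) (hCP κ a ha)
      (fun p : κ × ι => (p.1, (Sum.inr p.2 : ι ⊕ ι)))
  exact iInf₂_le_of_le (matrixToMap u) (matrixToMap u') (iInf_le_of_le ((isCP_block_iff _ _ _).2 hCP)
    (max_le_max (cbNorm_matrixToMap_le_deltaAbs hu) (cbNorm_matrixToMap_le_deltaAbs hu')))

/-- Complete a matrix `A` of norm `< 1` to a positive block, apply the c.p. `2 × 2` map to it, and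
compress to the indices where both block labels agree. The result is a positive block with corner
`T(A)`. -/
theorem cbNorm_le_decNorm (T : V →ₗ[ℂ] Matrix ι ι W) : cbNorm T ≤ decNorm T := by
  refine le_iInf₂ fun S₁ S₂ => le_iInf fun h => ?_
  refine cbNorm_le_of_forall_lt_one fun κ _ A hA => ?_
  obtain ⟨a, b, ha1, hb1, hab⟩ := exists_fromBlocks_mem_cone hA
  have h1 := submatrix_mem_cone (X := W) (A := Matrix.comp _ _ ι ι W (Matrix.comp _ _ (Fin 2) (Fin 2)
    (Matrix ι ι W) ((Matrix.fromBlocks a A Aᴴ b).map (matrixMap !![S₁, T; adjointMap T, S₂]))))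
    (h _ _ hab)
    (Sum.elim (fun p : κ × ι => ((Sum.inl p.1, 0), p.2)) (fun p : κ × ι => ((Sum.inr p.1, 1), p.2)))
  have e : (Matrix.comp _ _ ι ι W (Matrix.comp _ _ (Fin 2) (Fin 2)
    (Matrix ι ι W) ((Matrix.fromBlocks a A Aᴴ b).map (matrixMap !![S₁, T; adjointMap T, S₂])))).submatrix
    (Sum.elim (fun p : κ × ι => ((Sum.inl p.1, 0), p.2)) (fun p : κ × ι => ((Sum.inr p.1, 1), p.2)))
    (Sum.elim (fun p : κ × ι => ((Sum.inl p.1, 0), p.2)) (fun p : κ × ι => ((Sum.inr p.1, 1), p.2)))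
    = Matrix.fromBlocks (Matrix.comp κ κ ι ι W (a.map S₁)) (Matrix.comp κ κ ι ι W (A.map T))
      (Matrix.comp κ κ ι ι W (Aᴴ.map (adjointMap T))) (Matrix.comp κ κ ι ι W (b.map S₂)) := by
    ext i j
    cases i <;> cases j <;> rfl
  rw [e] at h1
  exact (mnorm_le_of_fromBlocks_mem_cone h1).trans
    (max_le_max (mnorm_map_le_cbNorm ha1.le) (mnorm_map_le_cbNorm hb1.le))

end TensorMaps

/-! ## Bounded maps of finite rank -/

theorem Seminorm.exists_bound_of_finiteDimensional {E : Type*} [AddCommGroup E] [Module ℂ E]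
    [FiniteDimensional ℂ E] (p : Seminorm ℂ E) (hp : ∀ x, p x = 0 → x = 0) (f : E →ₗ[ℂ] ℂ) :
    ∃ C : ℝ≥0, ∀ x, ‖f x‖ ≤ C * p x := by
  let _ : Norm E := ⟨p⟩
  have core : NormedSpace.Core ℂ E :=
    { norm_nonneg := apply_nonneg p
      norm_smul := map_smul_eq_mul p
      norm_triangle := map_add_le_add p
      norm_eq_zero_iff := fun x => ⟨hp x, fun h => by rw [h]; exact map_zero p⟩ }
  let _ : NormedAddCommGroup E := NormedAddCommGroup.ofCore core
  let _ : NormedSpace ℂ E := NormedSpace.ofCore core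
  let g : E →L[ℂ] ℂ := LinearMap.toContinuousLinearMap f
  exact ⟨‖g‖₊, fun x => g.le_opNorm x⟩

section FiniteRank

variable {V : Type u} [AddCommGroup V] [Module ℂ V] [StarAddMonoid V] [StarModule ℂ V]
  [MatrixNormCone V] [MatrixRegularOperatorSpace V]
variable {W : Type v} [AddCommGroup W] [Module ℂ W] [StarAddMonoid W] [StarModule ℂ W]
  [MatrixNormCone W] [MatrixRegularOperatorSpace W]
variable {ι κ : Type} [Fintype ι] [Fintype κ]

open MatrixOrderedOperatorSpace MatrixRegularOperatorSpace

variable (W) in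
/-- The norm of an operator space as a seminorm. -/
def elemSeminorm : Seminorm ℂ W :=
  Seminorm.of (fun w => rnorm (Matrix.of fun _ _ : Unit => w))
    (fun x y => rnorm_add_le (Matrix.of fun _ _ : Unit => x) (Matrix.of fun _ _ : Unit => y))
    (fun c x => rnorm_smul c (Matrix.of fun _ _ : Unit => x))

theorem ofReal_elemSeminorm (w : W) : ENNReal.ofReal (elemSeminorm W w) = elemNorm w :=
  ofReal_rnorm _

theorem eq_zero_of_elemSeminorm {w : W} (h : elemSeminorm W w = 0) : w = 0 := by
  have h1 : elemNorm w = 0 := by rw [← ofReal_elemSeminorm, h, ENNReal.ofReal_zero]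
  exact congrFun (congrFun (OperatorSpace.eq_zero_of_mnorm _ h1) ()) ()

/-- Expand `T` in a basis of its range. The coordinates are bounded since the range is a finite
dimensional normed space. -/
theorem exists_tensorToMap_eq {T : V →ₗ[ℂ] W} (hT : IsBoundedMap T)
    [FiniteDimensional ℂ (LinearMap.range T)] : ∃ t, tensorToMap V W t = T := by
  let b := Module.finBasis ℂ (LinearMap.range T)
  have hb : ∀ i, IsBoundedMap (b.coord i ∘ₗ T.rangeRestrict) := by
    intro i
    obtain ⟨C, hC⟩ := Seminorm.exists_bound_of_finiteDimensional
      ((elemSeminorm W).comp (LinearMap.range T).subtype)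
      (fun x hx => Subtype.ext (eq_zero_of_elemSeminorm hx)) (b.coord i)
    obtain ⟨D, hD⟩ := hT
    refine ⟨C * D, fun x => ?_⟩
    rw [elemNorm_complex, LinearMap.comp_apply, ← ofReal_norm]
    refine (ENNReal.ofReal_le_ofReal (hC (T.rangeRestrict x))).trans ?_
    rw [ENNReal.ofReal_mul C.coe_nonneg, ENNReal.ofReal_coe_nnreal, ENNReal.coe_mul, mul_assoc]
    refine mul_le_mul_right ?_ _
    exact (ofReal_elemSeminorm (T x)).le.trans (hD x)
  refine ⟨∑ i, (⟨_, hb i⟩ : boundedDual V) ⊗ₜ[ℂ] (b i : W), ?_⟩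
  ext v
  have h := congrArg (LinearMap.range T).subtype (b.sum_repr (T.rangeRestrict v))
  rw [map_sum] at h
  rw [map_sum, LinearMap.sum_apply]
  exact h

theorem finiteDimensional_range (h : FiniteDimensional ℂ V ∨ FiniteDimensional ℂ W)
    (T : V →ₗ[ℂ] W) : FiniteDimensional ℂ (LinearMap.range T) := by
  rcases h with h | h <;> infer_instance

theorem isBoundedMap_of_mem_decMaps {T : V →ₗ[ℂ] W} (hT : T ∈ decMaps V W) : IsBoundedMap T := by
  induction hT using Submodule.span_induction with
  | mem T hT => exact isBoundedMap_of_cbNorm hT.2.ne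
  | zero => exact ⟨0, fun x => by
      rw [LinearMap.zero_apply]
      exact (mnorm_zero (X := W) (ι := Unit)).le.trans zero_le⟩
  | add S T _ _ hS hT =>
    obtain ⟨C, hC⟩ := hS
    obtain ⟨D, hD⟩ := hT
    refine ⟨C + D, fun x => ?_⟩
    rw [ENNReal.coe_add, add_mul]
    exact (OperatorSpace.mnorm_add_le (Matrix.of fun _ _ : Unit => S x)
      (Matrix.of fun _ _ : Unit => T x)).trans (add_le_add (hC x) (hD x))
  | smul c T _ hT =>
    obtain ⟨C, hC⟩ := hT
    refine ⟨‖c‖₊ * C, fun x => ?_⟩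
    rw [ENNReal.coe_mul, mul_assoc]
    exact (OperatorSpace.mnorm_smul c (Matrix.of fun _ _ : Unit => T x)).le.trans
      (mul_le_mul_right (hC x) _)

theorem exists_matrixToMap_eq (h : FiniteDimensional ℂ V ∨ FiniteDimensional ℂ W)
    {S : V →ₗ[ℂ] Matrix ι ι W} (hS : cbNorm S ≠ ∞) :
    ∃ u : Matrix ι ι (boundedDual V ⊗[ℂ] W), matrixToMap u = S := by
  have hb : ∀ i j, IsBoundedMap (Matrix.entryLinearMap ℂ W i j ∘ₗ S) := by
    intro i j
    obtain ⟨C, hC⟩ := isBoundedMap_of_cbNorm hS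
    refine ⟨C, fun x => le_trans ?_ (hC x)⟩
    exact mnorm_submatrix_le (Matrix.comp Unit Unit ι ι W (Matrix.of fun _ _ : Unit => S x))
      (e := fun _ : Unit => ((), i)) (f := fun _ : Unit => ((), j))
      (Function.injective_of_subsingleton _) (Function.injective_of_subsingleton _)
  have hex : ∀ i j, ∃ t, tensorToMap V W t = Matrix.entryLinearMap ℂ W i j ∘ₗ S := fun i j => by
    have := finiteDimensional_range h (Matrix.entryLinearMap ℂ W i j ∘ₗ S)
    exact exists_tensorToMap_eq (hb i j)
  choose u hu using hex
  refine ⟨Matrix.of u, ?_⟩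
  ext v i j
  exact LinearMap.congr_fun (hu i j) v

/-- A diagonal entry of infinite cb norm makes the bound trivial; any other has entries of finite
rank and comes from a tensor. -/
theorem deltaNorm_le_decNorm (h : FiniteDimensional ℂ V ∨ FiniteDimensional ℂ W)
    (z : Matrix ι ι (boundedDual V ⊗[ℂ] W)) : deltaNorm z ≤ decNorm (matrixToMap z) := by
  refine le_iInf₂ fun S₁ S₂ => le_iInf fun hCP => ?_
  by_cases h1 : cbNorm S₁ = ∞
  · rw [h1]; simp
  by_cases h2 : cbNorm S₂ = ∞
  · rw [h2]; simp
  obtain ⟨u, rfl⟩ := exists_matrixToMap_eq h h1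
  obtain ⟨u', rfl⟩ := exists_matrixToMap_eq h h2
  exact iInf₂_le_of_le u u' (iInf_le_of_le ((mem_deltaCone_iff _).2 ((isCP_block_iff _ _ _).1 hCP))
    (max_le_max (deltaAbs_le_cbNorm_matrixToMap u) (deltaAbs_le_cbNorm_matrixToMap u')))

/-! ## The cones of `V^* ⊗_δ W` -/

theorem matrixToMap_sub (z y : Matrix ι ι (boundedDual V ⊗[ℂ] W)) :
    matrixToMap (z - y) = matrixToMap z - matrixToMap y := by
  ext v i j
  simp [matrixToMap_apply]

theorem deltaNorm_zero : deltaNorm (0 : Matrix ι ι (boundedDual V ⊗[ℂ] W)) = 0 := by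
  have h0 : ∀ (κ : Type) [Fintype κ],
      matrixToMap (0 : Matrix κ κ (boundedDual V ⊗[ℂ] W)) = 0 := fun κ _ => by
    ext v i j
    simp [matrixToMap_apply]
  have h1 : deltaAbs (0 : Matrix ι ι (boundedDual V ⊗[ℂ] W)) ≤ 0 := by
    refine (deltaAbs_le_cbNorm_matrixToMap _).trans (cbNorm_le_of_forall fun κ _ a => ?_)
    rw [h0, (by ext; simp : a.map (0 : V →ₗ[ℂ] Matrix ι ι W) = 0), mnorm_zero]
    exact zero_le
  refine le_antisymm (iInf₂_le_of_le 0 0 (iInf_le_of_le ?_ (max_le h1 h1))) zero_le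
  rw [Matrix.conjTranspose_zero, Matrix.fromBlocks_zero, mem_deltaCone_iff, h0]
  intro κ _ a _
  exact zero_mem_cone (V := W) (κ × (ι ⊕ ι))

/-- The δ-norm dominates the cb norm, so δ-approximation of `z` approximates `T_z(a)` for each `a`,
and the cone of `W` is closed. -/
theorem mem_cone_tensor_iff (z : Matrix ι ι (boundedDual V ⊗[ℂ] W)) :
    z ∈ (instMatrixNormConeDelta (V := boundedDual V) (W := W)).cone ι ↔ IsCP (matrixToMap z) := by
  constructor
  · intro hz κ _ a ha
    refine cone_closed (V := W) (Matrix.comp κ κ ι ι W (a.map (matrixToMap z))) fun ε hε => ?_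
    have hne : mnorm a + 1 ≠ ∞ := ENNReal.add_ne_top.2
      ⟨OperatorSpace.mnorm_ne_top a, ENNReal.one_ne_top⟩
    -- The `+ 1` keeps the divisor nonzero when `a = 0`.
    obtain ⟨y, hy, hyz⟩ := hz (ε / (mnorm a + 1)) (ENNReal.div_pos hε.ne' hne)
    refine ⟨_, (mem_deltaCone_iff y).1 hy κ a ha, ?_⟩
    have h1 := (mnorm_map_le (matrixToMap (z - y)) a).trans (mul_le_mul_left
      ((cbNorm_le_decNorm _).trans (decNorm_matrixToMap_le (z - y))) _)
    rw [ENNReal.lt_div_iff_mul_lt (Or.inl (by simp)) (Or.inl hne)] at hyz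
    refine lt_of_le_of_lt ?_ ((mul_le_mul_right le_self_add _).trans_lt hyz)
    refine le_trans (le_of_eq ?_) h1
    rw [matrixToMap_sub]
    rfl
  · intro hz ε hε
    refine ⟨z, (mem_deltaCone_iff z).2 hz, ?_⟩
    exact ((congrArg deltaNorm (sub_self z)).trans deltaNorm_zero).trans_lt hε

end FiniteRank

end

theorem mainTheorem6 {V : Type u} [AddCommGroup V] [Module ℂ V] [StarAddMonoid V]
    [StarModule ℂ V] [MatrixNormCone V] [MatrixRegularOperatorSpace V]
    {W : Type v} [AddCommGroup W] [Module ℂ W] [StarAddMonoid W]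
    [StarModule ℂ W] [MatrixNormCone W] [MatrixRegularOperatorSpace W] :
    ∃ Ψ : boundedDual V ⊗[ℂ] W →ₗ[ℂ] decMaps V W,
      (∀ (f : boundedDual V) (w : W) (v : V),
        (Ψ (f ⊗ₜ[ℂ] w) : V →ₗ[ℂ] W) v = (f : V →ₗ[ℂ] ℂ) v • w) ∧
      IsCompleteContraction (X := boundedDual V ⊗[ℂ] W) (Y := decMaps V W) Ψ ∧
      IsCompleteOrderEmbedding (X := boundedDual V ⊗[ℂ] W) (Y := decMaps V W) Ψ ∧
      (FiniteDimensional ℂ V ∨ FiniteDimensional ℂ W →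
        Function.Bijective Ψ ∧ IsCompleteIsometry (X := boundedDual V ⊗[ℂ] W) (Y := decMaps V W) Ψ) := by
  have hinj : Function.Injective ((tensorToMap V W).codRestrict (decMaps V W)
      tensorToMap_mem_decMaps) := fun x y h =>
    tensorToMap_injective (congrArg Subtype.val h)
  refine ⟨(tensorToMap V W).codRestrict (decMaps V W) tensorToMap_mem_decMaps, fun f w v => rfl,
    fun ι _ z => decNorm_matrixToMap_le z, ⟨hinj, fun ι _ z => (mem_cone_tensor_iff z).symm⟩,
    fun hfin => ⟨⟨hinj, fun T => ?_⟩, fun ι _ z =>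
      le_antisymm (decNorm_matrixToMap_le z) (deltaNorm_le_decNorm hfin z)⟩⟩
  have := finiteDimensional_range hfin T.1
  obtain ⟨t, ht⟩ := exists_tensorToMap_eq (isBoundedMap_of_mem_decMaps T.2)
  exact ⟨t, Subtype.ext ht⟩
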